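/- **Setting.** For $\Psi\in\mathbb R$, $\varepsilon>0$ put $\Sigma(\Psi,\varepsilon)=\{re^{i\theta}: r>0,\ |\theta-\Psi|<\varepsilon\}$. Let $S=\{a_n\}_{n\ge1}\subset\mathbb C$ satisfy $0<|a_1|\le|a_2|\le\dots\to\infty$, let $\alpha=\limsup_{n\to\infty}\ln n/\ln|a_n|$ be finite, and let $\varepsilon>0$, $\Psi\in[-\pi,\pi)$ be such that no $a_n$ lies in $\Sigma(\Psi,\varepsilon)$. Let $F$ be an entire function whose zeros, counted with multiplicity, are exactly the $a_n$, and whose order of growth is minimal (that is, equal to $\alpha$). Let $\ln F$ be a holomorphic branch of the logarithm of $F$ on $\Sigma(\Psi,\varepsilon)$, and suppose that for some integers $m\ge1$, $N\ge 0$, some $\delta>0$ with $N/m>\alpha-\delta$ and some complex numbers $d_{j,k}$, $$\ln F(z)=\sum_{j=0}^{N}\sum_{k=0}^{1}d_{j,k}\,z^{\alpha-j/m}\ln^k z+o\big(|z|^{\alpha-N/m-\delta}\big),\qquad z\to\infty,\ z\in\Sigma(\Psi,\varepsilon),$$ where $\operatorname{Im}\ln z\in(\Psi-\varepsilon,\Psi+\varepsilon)$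 and $z^\beta=e^{\beta\ln z}$. Put $d_{j,k}=0$ for $j>N$. Let $A,B\in\mathbb C$, $A\ne0$, with $\lambda_n=Aa_n+B\neq0$ for all $n$, let $S_{A,B}=\{\lambda_n\}$ and $c=B/A$, and fix any value of $\ln A$. Let $\varepsilon'>0$ and $\Psi'\in(\Psi-\varepsilon,\Psi+\varepsilon)$ be such that no $a_n+c$ lies in $\Sigma(\Psi',\varepsilon')$ and such that $z-c\in\Sigma(\Psi,\varepsilon)$ for all $z\in\Sigma(\Psi',\varepsilon')$ of sufficiently large modulus. Let $\ln F(z-c)$ denote the holomorphic branch of the logarithm of $F(z-c)$ on $\Sigma(\Psi',\varepsilon')$ that agrees for large $|z|$ with the given branch of $\ln F$ evaluated at $z-c$. For integers $j\ge0$ and $k\in\{0,1\}$ let $$\Omega_{j,k}=\sum_{l=0}^{\min\{\lfloor j/m\rfloor,\,1-k\}}\ \sum_{n=0}^{\lfloor j/m\rfloor-l}\binom{l+k}{k}\,d_{j-m(l+n),\,l+k}\ \mu_{l,n}\!\left(\alpha-\tfrac{j-m(l+n)}{m}\right),$$ $$\mu_{l,n}(\beta)=(-c)^{l+n}\sum_{i=0}^{n}\frac{l!}{(l+i)!}\binom{\beta}{n-i}s(l+i,l),$$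 with $s(\cdot,\cdot)$ the signed Stirling numbers of the first kind; $\Omega_{j,k}$ is the coefficient of $z^{\alpha-j/m}\ln^kz$ obtained by formally expanding $\sum_{j,k} d_{j,k}(z-c)^{\alpha-j/m}\ln^k(z-c)$ at $z=\infty$. Let $\zeta_{S_{A,B}}(s)=\sum_{n\ge1}\lambda_n^{-s}$ for $\operatorname{Re}s>\alpha$, where $\lambda_n^{-s}$ is formed with $\arg\lambda_n\in(\Psi'+\arg A-2\pi,\ \Psi'+\arg A)$, $\arg A=\operatorname{Im}\ln A$. **Theorem.** The limit $\ln F(-B/A):=\lim_{z\to0,\ z\in\Sigma(\Psi',\varepsilon')}\ln F(z-B/A)$ exists. The series for $\zeta_{S_{A,B}}(s)$ converges absolutely for $\operatorname{Re}s>\alpha$, and $\zeta_{S_{A,B}}$ extends meromorphically to a half-plane $\operatorname{Re}s>\sigma$ with some $\sigma<0$; the extension is regular at $s=0$. If $\alpha-j/m\ne0$ for every integer $j\ge0$, then $$\zeta_{S_{A,B}}'(0)=-\ln F(-B/A).$$ If $\alpha-j'/m=0$ for an integer $j'\ge0$, then $$\zeta_{S_{A,B}}'(0)=i\pi\,\Omega_{j',1}+\Omega_{j',0}-\Omega_{j',1}\ln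 A-\ln F(-B/A).$$ -/

import Mathlib

open Filter Topology Asymptotics

noncomputable section

namespace ZetaSeq

/-- The open sector of all `r e^{iθ}` with `r > 0` and `|θ - Ψ| < ε`. -/
def sector (Ψ ε : ℝ) : Set ℂ :=
  {z | ∃ r : ℝ, 0 < r ∧ ∃ θ : ℝ, |θ - Ψ| < ε ∧ z = (r : ℂ) * Complex.exp ((θ : ℂ) * Complex.I)}

/-- The branch of the logarithm (of `z ≠ 0`) whose imaginary part lies in `(θ - π, θ + π]`. -/
def logBranch (θ : ℝ) (z : ℂ) : ℂ :=
  Complex.log (z * Complex.exp (-((θ : ℂ) * Complex.I))) + (θ : ℂ) * Complex.I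

/-- The power `z ^ s`, for `z` off the ray of argument `Ψ`, with branch cut along that ray and
with `arg z ∈ (Ψ - 2π, Ψ)`. -/
def cutPow (Ψ : ℝ) (z s : ℂ) : ℂ :=
  Complex.exp (s * logBranch (Ψ - Real.pi) z)

/-- The standing conditions on a sequence `a 0, a 1, …` (written `a₁, a₂, …` on paper):
nonzero terms of nondecreasing modulus tending to infinity, finite exponent of convergence `α`,
and no term in the sector of half-angle `ε` about the ray of argument `Ψ`. -/
structure IsAdmissible (a : ℕ → ℂ) (α Ψ ε : ℝ) : Prop where
  pos : 0 < ‖a 0‖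
  mono : Monotone fun n => ‖a n‖
  tendsto : Tendsto (fun n => ‖a n‖) atTop atTop
  exponent :
    limsup (fun n : ℕ => ((Real.log ((n : ℝ) + 1) / Real.log ‖a n‖ : ℝ) : EReal)) atTop
      = (α : EReal)
  eps_pos : 0 < ε
  angle_mem : Ψ ∈ Set.Ico (-Real.pi) Real.pi
  not_mem : ∀ n, a n ∉ sector Ψ ε

/-- `F` is a characteristic function of the sequence `a` with exponent of convergence `α`:
an entire function whose zeros, counted with multiplicity, are the terms of `a`, and whose order
of growth is minimal. As any entire function with these zeros has order at least `α`,
minimality says that the order is at most `α`. -/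
structure IsCharacteristic (a : ℕ → ℂ) (α : ℝ) (F : ℂ → ℂ) : Prop where
  entire : Differentiable ℂ F
  zeros : ∀ z, analyticOrderAt F z = Set.encard {n | a n = z}
  order_le : ∀ ρ : ℝ, α < ρ →
    F =O[Bornology.cobounded ℂ] fun z => Real.exp (‖z‖ ^ ρ)

/-- `L` is a holomorphic branch of `log G` on `U`. -/
structure IsLogOn (L G : ℂ → ℂ) (U : Set ℂ) : Prop where
  differentiableOn : DifferentiableOn ℂ L U
  exp_eq : ∀ z ∈ U, Complex.exp (L z) = G z

/-- The filter of `z → ∞` inside the sector of half-angle `ε` about argument `Ψ`. -/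
def sectorAtInfty (Ψ ε : ℝ) : Filter ℂ :=
  Bornology.cobounded ℂ ⊓ 𝓟 (sector Ψ ε)

/-- The expansion
`L z = ∑_{j ≤ N} ∑_{k ≤ M} d j k * z ^ (α - j/m) * (log z) ^ k + o (z ^ (α - N/m - δ))`
as `z → ∞` in the sector, where `log z` has imaginary part near `Ψ`
(namely in `(Ψ - ε, Ψ + ε)`) and `z ^ β = exp (β * log z)`. -/
structure HasExpansion (L : ℂ → ℂ) (α Ψ ε : ℝ) (m M N : ℕ) (δ : ℝ) (d : ℕ → ℕ → ℂ) : Prop where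
  m_pos : 0 < m
  delta_pos : 0 < δ
  lt_exponent : α - δ < (N : ℝ) / m
  isLittleO :
    (fun z => L z - ∑ j ∈ Finset.range (N + 1), ∑ k ∈ Finset.range (M + 1),
        d j k * Complex.exp (((α - (j : ℝ) / m : ℝ) : ℂ) * logBranch Ψ z) * logBranch Ψ z ^ k)
      =o[sectorAtInfty Ψ ε] fun z => ‖z‖ ^ (α - (N : ℝ) / m - δ)

/-- The signed Stirling numbers of the first kind. -/
def stirlingSigned (n k : ℕ) : ℤ :=
  (-1) ^ (n + k) * (Nat.stirlingFirst n k : ℤ)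

/-- For `l ≤ k`, the coefficient of `z ^ (β - (k - l) - p)` times `binom k l * (log z) ^ l` in the
expansion of `(z - c) ^ β * (log (z - c)) ^ k` at infinity. -/
def mu (c : ℂ) (β : ℝ) (p l k : ℕ) : ℂ :=
  (-c) ^ (k - l + p) * ∑ n ∈ Finset.range (p + 1),
    ((k - l).factorial : ℂ) / ((k - l + n).factorial : ℂ) *
      ((Ring.choose β (p - n) : ℝ) : ℂ) * (stirlingSigned (k - l + n) (k - l) : ℂ)

/-- The coefficients `Ω_{j,k}` of `z ^ (α - j/m) * (log z) ^ k` in the expansion at infinity of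
`L (z - c)`, computed from the coefficients `d i p`, `i ≤ N`, `p ≤ M`, of the expansion of `L z`
(where `d i p` counts as zero for `i > N`). -/
def Omega (c : ℂ) (α : ℝ) (m M N : ℕ) (d : ℕ → ℕ → ℂ) (j k : ℕ) : ℂ :=
  ∑ l ∈ Finset.range (min (j / m) (M - k) + 1), ∑ n ∈ Finset.range (j / m - l + 1),
    ((l + k).choose k : ℂ) *
      (if j - m * (l + n) ≤ N then d (j - m * (l + n)) (l + k) else 0) *
      mu c (α - ((j - m * (l + n) : ℕ) : ℝ) / m) n k (l + k)

/-- `Z` is a meromorphic continuation, to an open half-plane containing `0`, of the zeta function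
`∑ (b n) ^ (-s)`, `Re s > α`, of the sequence `b`, the powers being taken with
`arg (b n) ∈ (Ψ - 2π, Ψ)`. The (absolute) convergence of the series is part of the assertion. -/
def IsZetaContinuation (b : ℕ → ℂ) (α Ψ : ℝ) (Z : ℂ → ℂ) : Prop :=
  (∀ s : ℂ, α < s.re → HasSum (fun n => cutPow Ψ (b n) (-s)) (Z s)) ∧
  ∃ σ : ℝ, σ < 0 ∧ MeromorphicOn Z {s : ℂ | σ < s.re}

end ZetaSeq

end

noncomputable section

namespace ZetaSeq

open MeasureTheory

/-! Put `c = B / A` and `w n = -(a n + c) e^{-iΨ'}`. Since no `a n + c` lies in the sector about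
`Ψ'`, the `w n` avoid a fixed sector about the negative real axis, and `λ_n^{-s} = e^{-sτ} (w
n)^{-s}` with `τ = ln A + i(Ψ' - π)` and principal powers on the right. The entire function `H(z) =
F(z e^{iΨ'} - c)` has the zeros `-w n`, and `f(r) = ln F(r e^{iΨ'} - c)` is a logarithm of it on the
positive axis, with limit `f₀ = ln F(-c)` at `0`.

Let `q = ⌊α⌋`. Hadamard's formula (`hasSum_taylorRem_logDeriv`) says that `H'/H` minus its Taylor
polynomial of degree `< q` equals `∑ (-r / w n)^q / (r + w n)`. For `α < Re s < q + 1` the Mellin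
integral of each term is `(w n)^{-s} π / sin πs` (`integral_cpow_neg_mul_pow_div`). Summation and
one integration by parts give `∑ (w n)^{-s} = (s sin(πs) / π) ∫ r^{-s-1} g(r) dr`, where `g` is `f -
f₀` minus a polynomial without constant term and `g = O(r^{q+1})` at `0` (`hasSum_cpow_neg`).

The integral over `(0, 1)` is holomorphic for `Re s < q + 1`. Over `(1, ∞)` the expansion of `ln F`
is used: `r^β` contributes `1 / (s - β)`, `r^β log r` contributes `1 / (s - β)^2`, and an error
`O(r^{-η})` is holomorphic for `Re s > -η`. So at `s = 0` only the exponent `β = 0` produces a pole,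
with principal part `(κ₀ - f₀) / s + κ₁ / s^2`, where `κ₀` and `κ₁` are the coefficients of `1` and
`log r` in the expansion of `f`. As `s sin(πs) / π = s^2 (1 + O(s^2))`, the pole is cancelled, and
the derivative at `0`, with the factor `e^{-sτ}` included, is `κ₀ - f₀ - τ κ₁`
(`exists_continuation`).

If some exponent `α - j'/m` vanishes, then `κ₁ = Ω_{j',1}` and `κ₀ = Ω_{j',0} + iΨ' Ω_{j',1}`;
otherwise both are `0` (`HasExpansion.hasTailMod`). The `Ψ'` terms cancel against `τ`, which leaves
the stated values. -/

/-! ### Hadamard's formula for the logarithmic derivative -/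

/-- Finitely many prescribed zeros of an entire function can be divided out. -/
lemma exists_eq_mul_prod_sub {H : ℂ → ℂ} (hH : Differentiable ℂ H) {v : ℕ → ℂ}
    (hz : ∀ z, analyticOrderAt H z = Set.encard {n | v n = z}) (s : Finset ℕ) :
    ∃ Q : ℂ → ℂ, Differentiable ℂ Q ∧ (∀ z, H z = Q z * ∏ n ∈ s, (z - v n)) ∧
      ∀ z, analyticOrderAt Q z = Set.encard {n | n ∉ s ∧ v n = z} := by
  classical
  induction s using Finset.induction_on with
  | empty => exact ⟨H, hH, by simp, by simpa using hz⟩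
  | insert k s hk ih =>
    obtain ⟨Q, hQ, hHQ, hord⟩ := ih
    have hset : ∀ z, z ≠ v k → {n | n ∉ insert k s ∧ v n = z} = {n | n ∉ s ∧ v n = z} := by
      intro z hz
      ext n
      simp only [Finset.mem_insert, Set.mem_ofPred_eq, not_or]
      constructor
      · rintro ⟨⟨_, h⟩, h'⟩; exact ⟨h, h'⟩
      · rintro ⟨h, h'⟩
        refine ⟨⟨?_, h⟩, h'⟩
        rintro rfl
        exact hz h'.symm
    have hset' : {n | n ∉ s ∧ v n = v k} = insert k {n | n ∉ insert k s ∧ v n = v k} := by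
      ext n
      simp only [Finset.mem_insert, Set.mem_ofPred_eq, not_or, Set.mem_insert_iff]
      constructor
      · rintro ⟨h, h'⟩
        by_cases hn : n = k
        · exact Or.inl hn
        · exact Or.inr ⟨⟨hn, h⟩, h'⟩
      · rintro (rfl | ⟨⟨_, h⟩, h'⟩)
        · exact ⟨hk, rfl⟩
        · exact ⟨h, h'⟩
    -- Indices rather than values are divided out, so a repeated zero loses one unit of order for
    -- each index removed.
    have hcard : analyticOrderAt Q (v k) =
        Set.encard {n | n ∉ insert k s ∧ v n = v k} + 1 := by
      rw [hord, hset', Set.encard_insert_of_notMem (by simp)]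
    have hQk : Q (v k) = 0 := by
      have : analyticOrderAt Q (v k) ≠ 0 := by rw [hcard]; simp
      exact (analyticOrderAt_ne_zero.1 this).2
    have hQ' : Differentiable ℂ (dslope Q (v k)) := by
      intro z
      have := (Complex.differentiableOn_dslope (f := Q) (c := v k) (s := Set.univ)
        Filter.univ_mem).2 hQ.differentiableOn
      exact (this z trivial).differentiableAt Filter.univ_mem
    have hfac : ∀ z, Q z = (z - v k) * dslope Q (v k) z := by
      intro z
      have := sub_smul_dslope Q (v k) z
      rw [hQk, sub_zero, smul_eq_mul] at this
      exact this.symm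
    refine ⟨dslope Q (v k), hQ', ?_, ?_⟩
    · intro z
      rw [Finset.prod_insert hk, hHQ z, hfac z]
      ring
    · intro z
      have hmul : analyticOrderAt Q z =
          analyticOrderAt (fun z => z - v k) z + analyticOrderAt (dslope Q (v k)) z := by
        rw [← analyticOrderAt_mul (by fun_prop) (hQ'.analyticAt z)]
        congr 1
        funext z
        exact hfac z
      by_cases hzk : z = v k
      · subst hzk
        rw [hcard, add_comm] at hmul
        have h1 : analyticOrderAt (fun z => z - v k) (v k) = 1 := by
          simp
        rw [h1] at hmul
        exact (ENat.add_right_injective_of_ne_top (n := 1) (by simp) hmul).symm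
      · have h1 : analyticOrderAt (fun z => z - v k) z = 0 := by
          rw [AnalyticAt.analyticOrderAt_eq_zero (by fun_prop)]
          exact sub_ne_zero.2 hzk
        rw [h1, zero_add, hord] at hmul
        rw [← hmul, hset z hzk]

/-- A nonvanishing holomorphic function on a disc has a holomorphic logarithm. -/
lemma exists_log_on_ball {Q : ℂ → ℂ} {R : ℝ} (hR : 0 < R)
    (hQ : DifferentiableOn ℂ Q (Metric.ball 0 R)) (h0 : ∀ z ∈ Metric.ball (0 : ℂ) R, Q z ≠ 0)
    (y : ℂ) (hy : Complex.exp y = Q 0) :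
    ∃ h : ℂ → ℂ, h 0 = y ∧ ∀ z ∈ Metric.ball (0 : ℂ) R,
      HasDerivAt h (logDeriv Q z) z ∧ Complex.exp (h z) = Q z := by
  have hd : DifferentiableOn ℂ (logDeriv Q) (Metric.ball 0 R) := by
    unfold logDeriv
    exact (hQ.deriv Metric.isOpen_ball).div hQ h0
  obtain ⟨h, hh0, hh⟩ := hd.isExactOn_ball.with_val_at 0 y
  refine ⟨h, hh0, fun z hz => ⟨hh z hz, ?_⟩⟩
  have hk : ∀ z ∈ Metric.ball (0 : ℂ) R,
      HasDerivAt (fun z => Complex.exp (-h z) * Q z) 0 z := by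
    intro z hz
    have hQz : HasDerivAt Q (deriv Q z) z :=
      (hQ.differentiableAt (Metric.isOpen_ball.mem_nhds hz)).hasDerivAt
    convert! (hh z hz).neg.cexp.mul hQz using 1
    rw [logDeriv_apply]
    field_simp [h0 z hz]
    ring
  have hconst := (convex_ball (0 : ℂ) R).is_const_of_fderivWithin_eq_zero (𝕜 := ℂ)
    (f := fun z => Complex.exp (-h z) * Q z)
    (fun z hz => (hk z hz).differentiableAt.differentiableWithinAt)
    (fun z hz => by
      rw [fderivWithin_of_isOpen Metric.isOpen_ball hz]
      ext
      simpa using (hk z hz).deriv)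
    hz (Metric.mem_ball_self hR)
  simp only [hh0] at hconst
  rw [← hy, ← Complex.exp_add, neg_add_cancel, Complex.exp_zero, Complex.exp_neg] at hconst
  field_simp [Complex.exp_ne_zero] at hconst
  exact hconst.symm

/-- Bound for the logarithmic derivative of a nonvanishing holomorphic function on a disc. -/
lemma norm_logDeriv_le {Q : ℂ → ℂ} {R M : ℝ} (hR : 0 < R) (hM : 0 < M)
    (hQ : DifferentiableOn ℂ Q (Metric.ball 0 R)) (h0 : ∀ z ∈ Metric.ball (0 : ℂ) R, Q z ≠ 0)
    (hb : ∀ z ∈ Metric.ball (0 : ℂ) R, ‖Q z‖ ≤ ‖Q 0‖ * Real.exp M) {z : ℂ} (hz : ‖z‖ ≤ R / 4) :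
    ‖logDeriv Q z‖ ≤ 8 * M / R := by
  have hQ0 := h0 0 (Metric.mem_ball_self hR)
  obtain ⟨h, hh0, hh⟩ := exists_log_on_ball hR (Q := fun z => Q z / Q 0) (hQ.div_const _)
    (fun z hz => div_ne_zero (h0 z hz) hQ0) 0 (by simp [hQ0])
  have hre : Set.MapsTo h (Metric.ball 0 R) {z | z.re ≤ M} := by
    intro z hz
    have h1 : ‖Complex.exp (h z)‖ ≤ Real.exp M := by
      rw [(hh z hz).2, norm_div, div_le_iff₀ (norm_pos_iff.2 hQ0), mul_comm]
      exact hb z hz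
    rw [Complex.norm_exp] at h1
    exact Real.exp_le_exp.1 h1
  have hdiff : DifferentiableOn ℂ h (Metric.ball 0 R) := fun z hz =>
    (hh z hz).1.differentiableAt.differentiableWithinAt
  -- Borel–Carathéodory bounds `h u` by `2M|u| / (R - |u|)`, which is at most `2M` here. A Cauchy
  -- estimate on the circle of radius `R / 4` about `z` then gives `8M / R`.
  have hbd : ∀ u : ℂ, ‖u‖ ≤ R / 2 → ‖h u‖ ≤ 2 * M := by
    intro u hu
    refine (Complex.borelCaratheodory_zero hM hdiff hre hR
      (by simpa using by linarith) hh0).trans ?_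
    rw [div_le_iff₀ (by linarith)]
    nlinarith
  have hlog : logDeriv Q z = deriv h z := by
    have hz' : z ∈ Metric.ball (0 : ℂ) R := by simpa using by linarith
    rw [(hh z hz').1.deriv]
    simp only [div_eq_mul_inv]
    rw [logDeriv_mul_const _ _ (inv_ne_zero hQ0)]
  rw [hlog]
  refine (Complex.norm_deriv_le_of_forall_mem_sphere_norm_le (R := R / 4) (C := 2 * M)
    (by positivity) ?_ ?_).trans (le_of_eq (by field_simp; ring))
  · apply DifferentiableOn.diffContOnCl
    refine hdiff.mono ?_
    intro u hu
    have := Metric.closure_ball_subset_closedBall hu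
    rw [mem_closedBall_iff_norm] at this
    have h2 := norm_le_norm_add_norm_sub' u z
    simp only [Metric.mem_ball, dist_zero_right]
    linarith
  · intro u hu
    rw [mem_sphere_iff_norm] at hu
    apply hbd
    have h2 := norm_le_norm_add_norm_sub' u z
    linarith

/-- The remainder of the Taylor polynomial of degree `< q` at `0`. -/
def taylorRem (q : ℕ) (g : ℂ → ℂ) (z : ℂ) : ℂ :=
  g z - ∑ i ∈ Finset.range q, ((i.factorial : ℂ))⁻¹ * iteratedDeriv i g 0 * z ^ i

lemma taylorRem_add {q : ℕ} {f g : ℂ → ℂ} (hf : AnalyticAt ℂ f 0) (hg : AnalyticAt ℂ g 0)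
    (z : ℂ) : taylorRem q (f + g) z = taylorRem q f z + taylorRem q g z := by
  unfold taylorRem
  rw [Finset.sum_congr rfl fun i _ => by
    rw [iteratedDeriv_add hf.contDiffAt hg.contDiffAt, mul_add, add_mul], Finset.sum_add_distrib,
    Pi.add_apply]
  ring

lemma taylorRem_sum {q : ℕ} {s : Finset ℕ} {f : ℕ → ℂ → ℂ} (hf : ∀ n ∈ s, AnalyticAt ℂ (f n) 0)
    (z : ℂ) : taylorRem q (∑ n ∈ s, f n) z = ∑ n ∈ s, taylorRem q (f n) z := by
  classical
  induction s using Finset.induction_on with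
  | empty =>
    simp only [Finset.sum_empty, taylorRem]
    have : ∀ i, iteratedDeriv i (0 : ℂ → ℂ) 0 = 0 := fun i => by
      simp
    simp [this]
  | insert k s hk ih =>
    have h1 : ∀ n ∈ s, AnalyticAt ℂ (f n) 0 := fun n hn => hf n (Finset.mem_insert_of_mem hn)
    rw [Finset.sum_insert hk, Finset.sum_insert hk, taylorRem_add (hf k (by simp))
      (Finset.analyticAt_sum _ h1), ih h1]

/-- Cauchy's estimates bound the `n`-th Taylor term by `C (‖z‖ / R) ^ n`; the tail from `q` on is
geometric with ratio at most `1/2`, whence the factor `2`. -/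
lemma norm_taylorRem_le {q : ℕ} {g : ℂ → ℂ} {R C : ℝ} (hR : 0 < R)
    (hg : DifferentiableOn ℂ g (Metric.closedBall 0 R))
    (hb : ∀ z : ℂ, ‖z‖ ≤ R → ‖g z‖ ≤ C) {z : ℂ} (hz : ‖z‖ ≤ R / 2) :
    ‖taylorRem q g z‖ ≤ 2 * C * (‖z‖ / R) ^ q := by
  have hC : 0 ≤ C := (norm_nonneg _).trans (hb 0 (by simpa using hR.le))
  have hsum := Complex.hasSum_taylorSeries_on_ball (f := g) (c := 0) (r := R) (z := z)
    (hg.mono Metric.ball_subset_closedBall) (by simpa using by linarith)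
  simp only [sub_zero, smul_eq_mul] at hsum
  have hcoef : ∀ n : ℕ, ‖((n.factorial : ℂ))⁻¹ * (z ^ n * iteratedDeriv n g 0)‖
      ≤ C * (‖z‖ / R) ^ n := by
    intro n
    have h1 := Complex.norm_iteratedDeriv_le_of_forall_mem_sphere_norm_le (f := g) (c := 0) n hR
      (C := C) (by
        apply DifferentiableOn.diffContOnCl
        exact hg.mono Metric.closure_ball_subset_closedBall)
      (fun u hu => hb u (by simpa using (mem_sphere_iff_norm.1 hu).le))
    have hn : (0 : ℝ) < n.factorial := by positivity
    rw [norm_mul, norm_mul, norm_inv, norm_pow, Complex.norm_natCast]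
    calc ((n.factorial : ℝ))⁻¹ * (‖z‖ ^ n * ‖iteratedDeriv n g 0‖)
        ≤ ((n.factorial : ℝ))⁻¹ * (‖z‖ ^ n * (n.factorial * C / R ^ n)) := by gcongr
      _ = C * (‖z‖ / R) ^ n := by
        rw [div_pow]
        field_simp
  have hx : ‖z‖ / R ≤ 1 / 2 := by
    rw [div_le_iff₀ hR]; linarith
  have hx0 : 0 ≤ ‖z‖ / R := by positivity
  have htail : HasSum (fun n : ℕ =>
      (((n + q).factorial : ℂ))⁻¹ * (z ^ (n + q) * iteratedDeriv (n + q) g 0))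
      (taylorRem q g z) := by
    have := (hasSum_nat_add_iff' q).2 hsum
    convert! this using 1
    unfold taylorRem
    congr 1
    exact Finset.sum_congr rfl fun i _ => by ring
  have hgeo : HasSum (fun n : ℕ => C * (‖z‖ / R) ^ q * (‖z‖ / R) ^ n)
      (C * (‖z‖ / R) ^ q * (1 - ‖z‖ / R)⁻¹) :=
    (hasSum_geometric_of_lt_one hx0 (by linarith)).mul_left _
  have h2 := htail.norm_le_of_bounded hgeo (fun n => (hcoef (n + q)).trans (le_of_eq (by
    rw [pow_add]; ring)))
  refine h2.trans ?_
  have h3 : (1 - ‖z‖ / R)⁻¹ ≤ 2 := by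
    rw [inv_le_comm₀ (by linarith) (by norm_num)]
    linarith
  calc C * (‖z‖ / R) ^ q * (1 - ‖z‖ / R)⁻¹ ≤ C * (‖z‖ / R) ^ q * 2 := by gcongr
    _ = _ := by ring

/-- The remainder of a geometric series is explicit, so this holds for every `z ≠ v`, also outside
the disc of convergence. -/
lemma taylorRem_inv_sub {q : ℕ} {v z : ℂ} (hv : v ≠ 0) (hz : z ≠ v) :
    taylorRem q (fun z => (z - v)⁻¹) z = (z / v) ^ q / (z - v) := by
  have hd : ∀ i : ℕ, iteratedDeriv i (fun z : ℂ => (z - v)⁻¹) 0 =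
      -(i.factorial : ℂ) * (v⁻¹) ^ (i + 1) := by
    intro i
    have := iter_deriv_inv_linear_sub (𝕜 := ℂ) i 1 v
    simp only [one_mul, one_pow, mul_one] at this
    rw [iteratedDeriv_eq_iterate, this]
    simp only [zero_sub]
    rw [show (-1 - (i : ℤ)) = -((i + 1 : ℕ) : ℤ) by push_cast; ring, zpow_neg, zpow_natCast,
      neg_pow v, mul_inv, inv_pow, pow_succ (-1 : ℂ) i]
    have h1 : ((-1 : ℂ) ^ i) * ((-1 : ℂ) ^ i) = 1 := by rw [← mul_pow]; simp
    have h2 : ((-1 : ℂ) ^ i) ≠ 0 := by simp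
    field_simp
  have hzv : z - v ≠ 0 := sub_ne_zero.2 hz
  unfold taylorRem
  simp only [hd]
  induction q with
  | zero => simp
  | succ q ih =>
    rw [Finset.sum_range_succ, ← sub_sub, ih]
    have hn : (q.factorial : ℂ) ≠ 0 := by exact_mod_cast q.factorial_ne_zero
    rw [div_pow, div_pow, pow_succ z, pow_succ v, inv_pow, pow_succ v]
    field_simp
    ring

lemma taylorRem_congr {q : ℕ} {f g : ℂ → ℂ} (h : f =ᶠ[𝓝 0] g) {z : ℂ} (hz : f z = g z) :
    taylorRem q f z = taylorRem q g z := by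
  unfold taylorRem
  rw [hz, Finset.sum_congr rfl fun i _ => by rw [h.iteratedDeriv_eq i]]

/-- Taylor remainder of the logarithmic derivative after division by finitely many zeros. -/
lemma taylorRem_logDeriv_mul_prod {H Q : ℂ → ℂ} (hQ : Differentiable ℂ Q) {v : ℕ → ℂ}
    (hv0 : ∀ n, v n ≠ 0) {s : Finset ℕ} (hHQ : ∀ z, H z = Q z * ∏ n ∈ s, (z - v n))
    (hQ0 : Q 0 ≠ 0) {q : ℕ} {z : ℂ} (hQz : Q z ≠ 0) (hz : ∀ n, z ≠ v n) :
    taylorRem q (logDeriv H) z =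
      taylorRem q (logDeriv Q) z + ∑ n ∈ s, (z / v n) ^ q / (z - v n) := by
  have hQa : ∀ u, AnalyticAt ℂ Q u := fun u => hQ.analyticAt u
  have hlog : AnalyticAt ℂ (logDeriv Q) 0 := (hQa 0).deriv.div (hQa 0) hQ0
  have hinv : ∀ n ∈ s, AnalyticAt ℂ (fun z : ℂ => (z - v n)⁻¹) 0 := fun n _ =>
    AnalyticAt.inv (by fun_prop) (by simpa using hv0 n)
  have key : ∀ u, Q u ≠ 0 → (∀ n ∈ s, u - v n ≠ 0) →
      logDeriv H u = (logDeriv Q + ∑ n ∈ s, fun z : ℂ => (z - v n)⁻¹) u := by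
    intro u hu hun
    have hH : H = fun z => Q z * ∏ n ∈ s, (z - v n) := funext hHQ
    rw [hH, logDeriv_mul u hu (Finset.prod_ne_zero_iff.2 hun) (hQ u) (by fun_prop),
      logDeriv_prod (fun n hn => hun n hn) (fun n _ => by fun_prop)]
    simp only [Pi.add_apply, Finset.sum_apply]
    congr 1
    refine Finset.sum_congr rfl fun n hn => ?_
    simp [logDeriv_apply]
  rw [taylorRem_congr (g := logDeriv Q + ∑ n ∈ s, fun z : ℂ => (z - v n)⁻¹),
    taylorRem_add hlog (Finset.analyticAt_sum _ hinv), taylorRem_sum hinv]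
  · congr 1
    exact Finset.sum_congr rfl fun n _ => taylorRem_inv_sub (hv0 n) (hz n)
  · have h1 : ∀ᶠ u in 𝓝 (0 : ℂ), Q u ≠ 0 := hQ.continuous.continuousAt.eventually_ne hQ0
    have h2 : ∀ᶠ u in 𝓝 (0 : ℂ), ∀ n ∈ s, u - v n ≠ 0 := by
      rw [Filter.eventually_all_finset]
      intro n _
      exact ContinuousAt.eventually_ne (by fun_prop) (by simpa using hv0 n)
    filter_upwards [h1, h2] with u hu hun using key u hu hun
  · exact key z hQz fun n _ => sub_ne_zero.2 (hz n)

/-- Growth bound for the Taylor remainder after removing the zeros of modulus at most `2R`. -/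
lemma norm_taylorRem_sub_sum_le {H : ℂ → ℂ} (hH : Differentiable ℂ H) {v : ℕ → ℂ}
    (hzer : ∀ z, analyticOrderAt H z = Set.encard {n | v n = z}) (hv0 : ∀ n, v n ≠ 0)
    {R M : ℝ} (hR : 0 < R) (hM : 0 < M) (hgrow : ∀ z, ‖z‖ = 4 * R → ‖H z‖ ≤ ‖H 0‖ * Real.exp M)
    {s : Finset ℕ} (hs : ∀ n, n ∈ s ↔ ‖v n‖ ≤ 2 * R) {q : ℕ} {z : ℂ} (hz : ∀ n, z ≠ v n)
    (hzR : ‖z‖ ≤ R / 4) :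
    ‖taylorRem q (logDeriv H) z - ∑ n ∈ s, (z / v n) ^ q / (z - v n)‖ ≤
      2 * (4 * M / R) * (‖z‖ / (R / 2)) ^ q := by
  obtain ⟨Q, hQ, hHQ, hord⟩ := exists_eq_mul_prod_sub hH hzer s
  have hQne : ∀ u ∈ Metric.ball (0 : ℂ) (2 * R), Q u ≠ 0 := by
    intro u hu
    have h0 : analyticOrderAt Q u = 0 := by
      rw [hord, Set.encard_eq_zero]
      ext n
      simp only [Set.mem_ofPred_eq, Set.mem_empty_iff_false, iff_false, not_and]
      rintro hn rfl
      rw [hs] at hn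
      simp only [Metric.mem_ball, dist_zero_right] at hu
      exact hn hu.le
    exact ((hQ.analyticAt u).analyticOrderAt_eq_zero).1 h0
  have hQ0 : Q 0 ≠ 0 := hQne 0 (Metric.mem_ball_self (by positivity))
  have hQz : Q z ≠ 0 := hQne z (by simpa using by linarith)
  rw [taylorRem_logDeriv_mul_prod hQ hv0 hHQ hQ0 hQz hz, add_sub_cancel_right]
  -- Maximum principle on the disc of radius `4R`: on its boundary each removed factor satisfies `‖y
  -- - v n‖ ≥ 4R - 2R ≥ ‖v n‖`, its modulus at `0`. Dividing by the factors therefore preserves the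
  -- bound relative to the value at `0`.
  have hQb : ∀ u ∈ Metric.ball (0 : ℂ) (2 * R), ‖Q u‖ ≤ ‖Q 0‖ * Real.exp M := by
    intro u hu
    refine Complex.norm_le_of_forall_mem_frontier_norm_le (U := Metric.ball (0 : ℂ) (4 * R))
      Metric.isBounded_ball hQ.diffContOnCl ?_ (subset_closure ?_)
    · intro y hy
      rw [frontier_ball _ (by positivity), mem_sphere_zero_iff_norm] at hy
      have h1 : ‖Q y‖ * ∏ n ∈ s, ‖y - v n‖ ≤ (‖Q 0‖ * ∏ n ∈ s, ‖v n‖) * Real.exp M := by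
        have h2 := hgrow y hy
        rw [hHQ, hHQ 0, norm_mul, norm_mul, norm_prod, norm_prod] at h2
        simpa using h2
      have hpos : 0 < ∏ n ∈ s, ‖v n‖ := Finset.prod_pos fun n _ => norm_pos_iff.2 (hv0 n)
      have h3 : ∏ n ∈ s, ‖v n‖ ≤ ∏ n ∈ s, ‖y - v n‖ := by
        refine Finset.prod_le_prod (fun n _ => norm_nonneg _) fun n hn => ?_
        have h4 := (hs n).1 hn
        have h5 := norm_sub_norm_le y (v n)
        linarith
      have h6 : ‖Q y‖ * ∏ n ∈ s, ‖v n‖ ≤ (‖Q 0‖ * Real.exp M) * ∏ n ∈ s, ‖v n‖ := by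
        calc ‖Q y‖ * ∏ n ∈ s, ‖v n‖ ≤ ‖Q y‖ * ∏ n ∈ s, ‖y - v n‖ := by gcongr
          _ ≤ _ := h1
          _ = _ := by ring
      exact le_of_mul_le_mul_right h6 hpos
    · refine Metric.ball_subset_ball ?_ hu
      linarith
  refine norm_taylorRem_le (by positivity) ?_ ?_ (by linarith)
  · intro u hu
    have hu' : u ∈ Metric.ball (0 : ℂ) (2 * R) := by
      simp only [Metric.mem_closedBall, dist_zero_right, Metric.mem_ball] at hu ⊢
      linarith
    exact ((hQ.analyticAt u).deriv.div (hQ.analyticAt u) (hQne u hu')).differentiableAt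
      |>.differentiableWithinAt
  · intro u hu
    refine (norm_logDeriv_le (R := 2 * R) (by positivity) hM hQ.differentiableOn hQne hQb
      (by linarith)).trans (le_of_eq ?_)
    field_simp
    ring

lemma summable_div_pow_div_sub {v : ℕ → ℂ} (hv0 : ∀ n, v n ≠ 0)
    (hvt : Tendsto (fun n => ‖v n‖) atTop atTop) {q : ℕ}
    (hsum : Summable fun n => (‖v n‖ ^ (q + 1))⁻¹) (z : ℂ) :
    Summable fun n => (z / v n) ^ q / (z - v n) := by
  refine Summable.of_norm_bounded_eventually_nat (g := fun n => ‖z‖ ^ q * 2 * (‖v n‖ ^ (q + 1))⁻¹)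
    (hsum.mul_left _) ?_
  filter_upwards [hvt.eventually_ge_atTop (2 * ‖z‖)] with n hn
  have hpos : 0 < ‖v n‖ := norm_pos_iff.2 (hv0 n)
  have h1 : ‖v n‖ / 2 ≤ ‖z - v n‖ := by
    have := norm_sub_norm_le (v n) z
    rw [norm_sub_rev] at this
    linarith
  rw [norm_div, norm_pow, norm_div]
  calc (‖z‖ / ‖v n‖) ^ q / ‖z - v n‖ ≤ (‖z‖ / ‖v n‖) ^ q / (‖v n‖ / 2) := by gcongr
    _ = _ := by rw [div_pow, pow_succ]; field_simp

/-- Hadamard's formula for the logarithmic derivative of an entire function of finite order. -/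
theorem hasSum_taylorRem_logDeriv {H : ℂ → ℂ} (hH : Differentiable ℂ H) {v : ℕ → ℂ}
    (hzer : ∀ z, analyticOrderAt H z = Set.encard {n | v n = z}) (hv0 : ∀ n, v n ≠ 0)
    (hvt : Tendsto (fun n => ‖v n‖) atTop atTop) {q : ℕ} {ρ K : ℝ} (hρ : 0 ≤ ρ) (hρq : ρ < q + 1)
    (hgrow : ∀ᶠ R : ℝ in atTop, ∀ z, ‖z‖ = R → ‖H z‖ ≤ K * Real.exp (K * R ^ ρ))
    (hsum : Summable fun n => (‖v n‖ ^ (q + 1))⁻¹) {z : ℂ} (hz : ∀ n, z ≠ v n) :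
    HasSum (fun n => (z / v n) ^ q / (z - v n)) (taylorRem q (logDeriv H) z) := by
  have hS := summable_div_pow_div_sub hv0 hvt hsum z
  have hfin : ∀ R : ℝ, {n | ‖v n‖ ≤ 2 * R}.Finite := by
    intro R
    have := hvt.eventually_gt_atTop (2 * R)
    rw [← Nat.cofinite_eq_atTop, Filter.eventually_cofinite] at this
    simpa only [not_lt] using this
  have hH0 : 0 < ‖H 0‖ := by
    rw [norm_pos_iff]
    refine ((hH.analyticAt 0).analyticOrderAt_eq_zero).1 ?_
    rw [hzer, Set.encard_eq_zero]
    ext n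
    simpa using hv0 n
  set s : ℝ → Finset ℕ := fun R => (hfin R).toFinset with hsdef
  have hs : ∀ R n, n ∈ s R ↔ ‖v n‖ ≤ 2 * R := by
    intro R n
    simp [hsdef]
  have hs_lim : Tendsto s atTop atTop := by
    rw [Filter.tendsto_atTop]
    intro t
    have : ∀ᶠ R : ℝ in atTop, ∀ n ∈ t, ‖v n‖ ≤ 2 * R := by
      rw [Filter.eventually_all_finset]
      intro n _
      filter_upwards [eventually_ge_atTop (‖v n‖ / 2)] with R hR
      linarith
    filter_upwards [this] with R hR n hn
    rw [hs]
    exact hR n hn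
  have hlim1 : Tendsto (fun R => ∑ n ∈ s R, (z / v n) ^ q / (z - v n)) atTop
      (𝓝 (∑' n, (z / v n) ^ q / (z - v n))) := hS.hasSum.comp hs_lim
  have hlim2 : Tendsto (fun R => taylorRem q (logDeriv H) z -
      ∑ n ∈ s R, (z / v n) ^ q / (z - v n)) atTop (𝓝 0) := by
    -- `exp c` absorbs the factor `K / ‖H 0‖`, and the added `1` makes `c` positive.
    set c : ℝ := |Real.log (K / ‖H 0‖)| + 1 with hc
    have hc0 : 0 < c := by positivity
    have hb : ∀ᶠ R : ℝ in atTop, ‖taylorRem q (logDeriv H) z -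
        ∑ n ∈ s R, (z / v n) ^ q / (z - v n)‖ ≤
        8 * (2 * ‖z‖) ^ q * ((|K| * 4 ^ ρ + c) * R ^ (ρ - (q + 1))) := by
      have h4 : Tendsto (fun R : ℝ => 4 * R) atTop atTop :=
        tendsto_id.const_mul_atTop (by norm_num)
      filter_upwards [h4.eventually hgrow, eventually_ge_atTop (1 : ℝ),
        eventually_ge_atTop (4 * ‖z‖)] with R hg hR1 hRz
      have hR : 0 < R := by linarith
      -- Otherwise `H` would vanish on a whole circle and, by the maximum principle, at `0`.
      have hK : 0 < K := by
        by_contra hK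
        push Not at hK
        have h1 : ∀ u, ‖u‖ = 4 * R → H u = 0 := by
          intro u hu
          have := hg u hu
          have h2 : K * Real.exp (K * (4 * R) ^ ρ) ≤ 0 :=
            mul_nonpos_of_nonpos_of_nonneg hK (Real.exp_pos _).le
          exact norm_le_zero_iff.1 (this.trans h2)
        have h3 := Complex.norm_le_of_forall_mem_frontier_norm_le
          (U := Metric.ball (0 : ℂ) (4 * R)) (C := 0) (z := 0)
          Metric.isBounded_ball hH.diffContOnCl (fun y hy => by
            rw [frontier_ball _ (by positivity), mem_sphere_zero_iff_norm] at hy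
            rw [h1 y hy, norm_zero])
          (subset_closure (Metric.mem_ball_self (by positivity)))
        linarith
      have hM : 0 < K * (4 * R) ^ ρ + c := by positivity
      have := norm_taylorRem_sub_sum_le hH hzer hv0 hR hM (fun u hu => by
        refine (hg u hu).trans ?_
        rw [add_comm, Real.exp_add, ← mul_assoc]
        gcongr
        rw [← div_le_iff₀' hH0]
        calc K / ‖H 0‖ = Real.exp (Real.log (K / ‖H 0‖)) := (Real.exp_log (by positivity)).symm
          _ ≤ Real.exp c := Real.exp_le_exp.2 (by
            rw [hc]; linarith [le_abs_self (Real.log (K / ‖H 0‖))]))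
        (hs R) (q := q) hz (by linarith)
      refine this.trans ?_
      have hRρ : 1 ≤ R ^ ρ := Real.one_le_rpow hR1 hρ
      rw [Real.mul_rpow (by norm_num) hR.le, abs_of_pos hK, Real.rpow_sub hR,
        show ((q : ℝ) + 1) = ((q + 1 : ℕ) : ℝ) by push_cast; ring, Real.rpow_natCast]
      have h5 : K * (4 ^ ρ * R ^ ρ) + c ≤ (K * 4 ^ ρ + c) * R ^ ρ := by nlinarith
      calc 2 * (4 * (K * (4 ^ ρ * R ^ ρ) + c) / R) * (‖z‖ / (R / 2)) ^ q
          ≤ 2 * (4 * ((K * 4 ^ ρ + c) * R ^ ρ) / R) * (‖z‖ / (R / 2)) ^ q := by gcongr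
        _ = _ := by
          rw [show ‖z‖ / (R / 2) = 2 * ‖z‖ / R by field_simp, div_pow, pow_succ]
          field_simp
          ring
    refine squeeze_zero_norm' hb ?_
    have h6 : Tendsto (fun R : ℝ => R ^ (ρ - (q + 1))) atTop (𝓝 0) := by
      have := tendsto_rpow_neg_atTop (y := (q : ℝ) + 1 - ρ) (by linarith)
      simpa using this
    simpa using (h6.const_mul (|K| * 4 ^ ρ + c)).const_mul (8 * (2 * ‖z‖) ^ q)
  have hlim3 := hlim2.add hlim1
  simp only [sub_add_cancel, zero_add] at hlim3
  have := tendsto_nhds_unique hlim3 tendsto_const_nhds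
  rw [← this]
  exact hS.hasSum

/-! ### The Stieltjes transform of a power -/

/-- `‖r + w‖² = r² + 2r Re w + ‖w‖² ≥ (1 - κ)(r² + ‖w‖²) ≥ (1 - κ)/2 · (r + ‖w‖)²`. A constant
independent of `r` is what makes the integrals below converge and sum. -/
lemma mul_add_norm_le_norm_add {κ : ℝ} (hκ : 0 ≤ κ) (hκ1 : κ < 1) {w : ℂ} (hw : -κ * ‖w‖ ≤ w.re)
    {r : ℝ} (hr : 0 ≤ r) : √((1 - κ) / 2) * (r + ‖w‖) ≤ ‖(r : ℂ) + w‖ := by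
  refine le_of_sq_le_sq ?_ (norm_nonneg _)
  rw [mul_pow, Real.sq_sqrt (by linarith), Complex.sq_norm, Complex.normSq_apply]
  have h := Complex.sq_norm w
  rw [Complex.normSq_apply] at h
  simp only [Complex.add_re, Complex.ofReal_re, Complex.add_im, Complex.ofReal_im, zero_add]
  nlinarith [mul_le_mul_of_nonneg_left hw hr, sq_nonneg (r - ‖w‖), mul_nonneg hr (norm_nonneg w),
    mul_nonneg hκ (sq_nonneg (r - ‖w‖))]

lemma exists_mul_add_norm_le_norm_add {w : ℂ} (hw : w ∈ Complex.slitPlane) :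
    ∃ c : ℝ, 0 < c ∧ ∀ r : ℝ, 0 ≤ r → c * (r + ‖w‖) ≤ ‖(r : ℂ) + w‖ := by
  have hw0 : 0 < ‖w‖ := norm_pos_iff.2 (Complex.slitPlane_ne_zero hw)
  have hlt : -w.re < ‖w‖ := by
    refine lt_of_le_of_ne ((neg_le_abs _).trans (Complex.abs_re_le_norm w)) fun h => ?_
    have h1 := Complex.sq_norm w
    rw [Complex.normSq_apply, ← h] at h1
    have him : w.im = 0 := by nlinarith
    rcases hw with h2 | h2
    · linarith
    · exact h2 him
  refine ⟨√((1 - max 0 (-w.re / ‖w‖)) / 2), ?_, fun r hr => mul_add_norm_le_norm_add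
    (le_max_left _ _) ?_ ?_ hr⟩
  · apply Real.sqrt_pos.2
    have : max 0 (-w.re / ‖w‖) < 1 := max_lt one_pos (by rwa [div_lt_one hw0])
    linarith
  · exact max_lt one_pos (by rwa [div_lt_one hw0])
  · have h1 : -w.re / ‖w‖ ≤ max 0 (-w.re / ‖w‖) := le_max_right _ _
    rw [div_le_iff₀ hw0] at h1
    linarith

lemma integrableOn_rpow_neg_div_add {σ t : ℝ} (hσ0 : 0 < σ) (hσ1 : σ < 1) (ht : 0 < t) :
    IntegrableOn (fun r : ℝ => r ^ (-σ) / (r + t)) (Set.Ioi 0) := by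
  have hmeas : Measurable fun r : ℝ => r ^ (-σ) / (r + t) := by fun_prop
  rw [← Set.Ioc_union_Ioi_eq_Ioi zero_le_one, integrableOn_union]
  constructor
  · have h1 : IntegrableOn (fun r : ℝ => r ^ (-σ)) (Set.Ioc 0 1) := by
      rw [← intervalIntegrable_iff_integrableOn_Ioc_of_le zero_le_one]
      exact intervalIntegral.intervalIntegrable_rpow' (by linarith)
    refine (h1.div_const t).mono' hmeas.aestronglyMeasurable ?_
    refine (ae_restrict_iff' measurableSet_Ioc).2 (Eventually.of_forall fun r hr => ?_)
    have hr0 : 0 < r := hr.1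
    rw [Real.norm_of_nonneg (by positivity)]
    gcongr
    linarith
  · have h1 : IntegrableOn (fun r : ℝ => r ^ (-σ - 1)) (Set.Ioi 1) :=
      integrableOn_Ioi_rpow_of_lt (by linarith) one_pos
    refine h1.mono' hmeas.aestronglyMeasurable ?_
    refine (ae_restrict_iff' measurableSet_Ioi).2 (Eventually.of_forall fun r hr => ?_)
    have hr0 : 0 < r := one_pos.trans hr
    rw [Real.norm_of_nonneg (by positivity), Real.rpow_sub_one hr0.ne']
    gcongr
    linarith

lemma integrableOn_cpow_neg_div_add {x w : ℂ} (hx0 : 0 < x.re) (hx1 : x.re < 1)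
    (hw : w ∈ Complex.slitPlane) :
    IntegrableOn (fun r : ℝ => (r : ℂ) ^ (-x) / (r + w)) (Set.Ioi 0) := by
  obtain ⟨c, hc, hcw⟩ := exists_mul_add_norm_le_norm_add hw
  have hw0 : 0 < ‖w‖ := norm_pos_iff.2 (Complex.slitPlane_ne_zero hw)
  have hmeas : Measurable fun r : ℝ => (r : ℂ) ^ (-x) / (r + w) := by fun_prop
  refine ((integrableOn_rpow_neg_div_add hx0 hx1 hw0).const_mul c⁻¹).mono'
    hmeas.aestronglyMeasurable ?_
  refine (ae_restrict_iff' measurableSet_Ioi).2 (Eventually.of_forall fun r hr => ?_)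
  have hr0 : 0 < r := hr
  rw [norm_div, Complex.norm_cpow_eq_rpow_re_of_pos hr0, Complex.neg_re]
  calc r ^ (-x.re) / ‖(r : ℂ) + w‖ ≤ r ^ (-x.re) / (c * (r + ‖w‖)) := by
        gcongr
        exact hcw r hr0.le
    _ = _ := by field_simp

/-- The substitution `u = 1 / (1 + r)` turns the Beta integral `B(x, 1 - x)` into this one, and the
reflection formula for `Γ` evaluates it. -/
lemma integral_cpow_neg_div_add_one {x : ℂ} (hx0 : 0 < x.re) (hx1 : x.re < 1) :
    ∫ r in Set.Ioi (0 : ℝ), (r : ℂ) ^ (-x) / (r + 1) = Real.pi / Complex.sin (Real.pi * x) := by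
  have h1 : Complex.betaIntegral x (1 - x) = Real.pi / Complex.sin (Real.pi * x) := by
    rw [Complex.betaIntegral_eq_Gamma_mul_div _ _ hx0 (by simpa using hx1),
      Complex.Gamma_mul_Gamma_one_sub]
    simp
  rw [← h1, Complex.betaIntegral, intervalIntegral.integral_of_le zero_le_one,
    integral_Ioc_eq_integral_Ioo]
  have himg : (fun r : ℝ => (1 + r)⁻¹) '' Set.Ioi 0 = Set.Ioo 0 1 := by
    ext u
    constructor
    · rintro ⟨r, hr, rfl⟩
      have hr0 : 0 < r := hr
      exact ⟨by positivity, inv_lt_one_of_one_lt₀ (by linarith)⟩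
    · rintro ⟨hu0, hu1⟩
      refine ⟨u⁻¹ - 1, ?_, by simp⟩
      have := (one_lt_inv₀ hu0).2 hu1
      simpa using this
  rw [← himg, integral_image_eq_integral_abs_deriv_smul measurableSet_Ioi
    (f' := fun r => -1 / (1 + r) ^ 2)]
  · refine setIntegral_congr_fun measurableSet_Ioi fun r hr => ?_
    have hr0 : (0 : ℝ) < r := hr
    have hpos : (0 : ℝ) < 1 + r := by linarith
    have e1 : |-1 / (1 + r) ^ 2| = ((1 + r) ^ 2)⁻¹ := by
      rw [neg_div, abs_neg, abs_of_pos (by positivity), one_div]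
    have e2 : (1 : ℂ) - (((1 + r)⁻¹ : ℝ) : ℂ) = ((r * (1 + r)⁻¹ : ℝ) : ℂ) := by
      rw [← Complex.ofReal_one, ← Complex.ofReal_sub]
      congr 1
      field_simp
      ring
    have hne : ((1 + r : ℝ) : ℂ) ≠ 0 := by exact_mod_cast hpos.ne'
    simp only [e1, e2]
    rw [show (1 - x - 1 : ℂ) = -x by ring, Complex.ofReal_mul,
      Complex.mul_cpow_ofReal_nonneg hr0.le (by positivity), Complex.real_smul]
    have e3 : (((1 + r)⁻¹ : ℝ) : ℂ) ^ (x - 1) * (((1 + r)⁻¹ : ℝ) : ℂ) ^ (-x)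
        = ((1 + r : ℝ) : ℂ) := by
      rw [← Complex.cpow_add _ _ (by exact_mod_cast (inv_pos.2 hpos).ne'),
        show x - 1 + -x = -1 by ring, Complex.cpow_neg_one]
      push_cast
      rw [inv_inv]
    calc (r : ℂ) ^ (-x) / (r + 1) = ((((1 + r) ^ 2)⁻¹ : ℝ) : ℂ) *
        ((r : ℂ) ^ (-x) * ((1 + r : ℝ) : ℂ)) := by
          push_cast at hne ⊢
          rw [add_comm (r : ℂ) 1]
          field_simp
      _ = _ := by rw [← e3]; ring
  · intro r hr
    have hr0 : (0 : ℝ) < r := hr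
    have := ((hasDerivAt_id r).const_add 1).inv (by simpa using by linarith)
    exact this.hasDerivWithinAt
  · intro r hr u hu h
    have h2 := inv_injective h
    linarith

lemma integral_cpow_neg_div_add_ofReal {x : ℂ} (hx0 : 0 < x.re) (hx1 : x.re < 1) {t : ℝ}
    (ht : 0 < t) : ∫ r in Set.Ioi (0 : ℝ), (r : ℂ) ^ (-x) / (r + t) =
      (t : ℂ) ^ (-x) * (Real.pi / Complex.sin (Real.pi * x)) := by
  have h1 := integral_comp_mul_left_Ioi (fun r : ℝ => (r : ℂ) ^ (-x) / (r + t)) 0 ht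
  rw [mul_zero] at h1
  have htc : (t : ℂ) ≠ 0 := by exact_mod_cast ht.ne'
  have h2 : ∫ r in Set.Ioi (0 : ℝ), ((t * r : ℝ) : ℂ) ^ (-x) / ((t * r : ℝ) + t) =
      ∫ r in Set.Ioi (0 : ℝ), ((t : ℂ)⁻¹ * (t : ℂ) ^ (-x)) * ((r : ℂ) ^ (-x) / (r + 1)) := by
    refine setIntegral_congr_fun measurableSet_Ioi fun r hr => ?_
    have hr0 : (0 : ℝ) < r := hr
    have hr1 : (r : ℂ) + 1 ≠ 0 := by exact_mod_cast (by linarith : r + 1 ≠ 0)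
    rw [Complex.ofReal_mul, Complex.mul_cpow_ofReal_nonneg ht.le hr0.le,
      show (t : ℂ) * r + t = t * (r + 1) by ring]
    field_simp
  rw [h2, integral_const_mul, integral_cpow_neg_div_add_one hx0 hx1, Complex.real_smul] at h1
  push_cast at h1
  have h3 : (t : ℂ) * ((t : ℂ)⁻¹ * (t : ℂ) ^ (-x) * (Real.pi / Complex.sin (Real.pi * x))) =
      t * ((t : ℂ)⁻¹ * ∫ r in Set.Ioi (0 : ℝ), (r : ℂ) ^ (-x) / (r + t)) := by rw [h1]
  rw [mul_inv_cancel_left₀ htc] at h3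
  rw [← h3]
  field_simp

lemma differentiableAt_integral_cpow_neg_div_add {x w₀ : ℂ} (hx0 : 0 < x.re) (hx1 : x.re < 1)
    (hw : w₀ ∈ Complex.slitPlane) :
    DifferentiableAt ℂ (fun w => ∫ r in Set.Ioi (0 : ℝ), (r : ℂ) ^ (-x) / (r + w)) w₀ := by
  obtain ⟨c, hc, hcw⟩ := exists_mul_add_norm_le_norm_add hw
  have hw0 : 0 < ‖w₀‖ := norm_pos_iff.2 (Complex.slitPlane_ne_zero hw)
  -- Moving `w₀` by less than this radius costs at most half of the lower bound `c (r + ‖w₀‖)`.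
  have hδ : 0 < c * ‖w₀‖ / 2 := by positivity
  have hlow : ∀ r : ℝ, 0 < r → ∀ w ∈ Metric.ball w₀ (c * ‖w₀‖ / 2),
      c / 2 * (r + ‖w₀‖) ≤ ‖(r : ℂ) + w‖ := by
    intro r hr w hw
    have h1 := hcw r hr.le
    have h2 : ‖(r : ℂ) + w₀‖ ≤ ‖(r : ℂ) + w‖ + ‖w - w₀‖ := by
      calc ‖(r : ℂ) + w₀‖ = ‖((r : ℂ) + w) - (w - w₀)‖ := by ring_nf
        _ ≤ _ := norm_sub_le _ _
    rw [mem_ball_iff_norm] at hw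
    nlinarith [mul_pos hc hr]
  refine (hasDerivAt_integral_of_dominated_loc_of_deriv_le (μ := volume.restrict (Set.Ioi 0))
    (F := fun w (r : ℝ) => (r : ℂ) ^ (-x) / (r + w))
    (F' := fun w (r : ℝ) => -((r : ℂ) ^ (-x) / (r + w) ^ 2))
    (bound := fun r => ((c / 2) ^ 2 * ‖w₀‖)⁻¹ * (r ^ (-x.re) / (r + ‖w₀‖)))
    (Metric.ball_mem_nhds w₀ hδ) ?_ ?_ ?_ ?_ ?_ ?_).2.differentiableAt
  · exact Eventually.of_forall fun w =>
      (by fun_prop : Measurable fun r : ℝ => (r : ℂ) ^ (-x) / (r + w)).aestronglyMeasurable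
  · exact integrableOn_cpow_neg_div_add hx0 hx1 hw
  · exact (by fun_prop :
      Measurable fun r : ℝ => -((r : ℂ) ^ (-x) / (r + w₀) ^ 2)).aestronglyMeasurable
  · refine (ae_restrict_iff' measurableSet_Ioi).2 (Eventually.of_forall fun r hr w hw => ?_)
    have hr0 : 0 < r := hr
    rw [norm_neg, norm_div, norm_pow, Complex.norm_cpow_eq_rpow_re_of_pos hr0, Complex.neg_re]
    calc r ^ (-x.re) / ‖(r : ℂ) + w‖ ^ 2 ≤ r ^ (-x.re) / (c / 2 * (r + ‖w₀‖)) ^ 2 := by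
          gcongr
          exact hlow r hr0 w hw
      _ ≤ r ^ (-x.re) / ((c / 2) ^ 2 * ‖w₀‖ * (r + ‖w₀‖)) := by
          rw [mul_pow, mul_assoc]
          gcongr
          nlinarith
      _ = _ := by field_simp
  · exact (integrableOn_rpow_neg_div_add hx0 hx1 hw0).const_mul _
  · refine (ae_restrict_iff' measurableSet_Ioi).2 (Eventually.of_forall fun r hr w hw => ?_)
    have hr0 : 0 < r := hr
    have hne : (r : ℂ) + w ≠ 0 := by
      rw [← norm_pos_iff]
      exact lt_of_lt_of_le (by positivity) (hlow r hr0 w hw)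
    have := (((hasDerivAt_id w).const_add (r : ℂ)).inv hne).const_mul ((r : ℂ) ^ (-x))
    simp only [id] at this
    convert! this using 1
    field_simp

/-- The Stieltjes transform of a power. -/
theorem integral_cpow_neg_div_add {x w : ℂ} (hx0 : 0 < x.re) (hx1 : x.re < 1)
    (hw : w ∈ Complex.slitPlane) : ∫ r in Set.Ioi (0 : ℝ), (r : ℂ) ^ (-x) / (r + w) =
      w ^ (-x) * (Real.pi / Complex.sin (Real.pi * x)) := by
  have hA : AnalyticOnNhd ℂ (fun w => ∫ r in Set.Ioi (0 : ℝ), (r : ℂ) ^ (-x) / (r + w))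
      Complex.slitPlane :=
    DifferentiableOn.analyticOnNhd (fun w hw =>
      (differentiableAt_integral_cpow_neg_div_add hx0 hx1 hw).differentiableWithinAt)
      Complex.isOpen_slitPlane
  have hB : AnalyticOnNhd ℂ (fun w : ℂ => w ^ (-x) * (Real.pi / Complex.sin (Real.pi * x)))
      Complex.slitPlane := fun w hw =>
    ((analyticAt_id.cpow analyticAt_const hw)).mul analyticAt_const
  have hpre : IsPreconnected Complex.slitPlane :=
    (Complex.isOpen_slitPlane.isConnected_iff_isPathConnected.2
      (Complex.starConvex_one_slitPlane.isPathConnected Complex.one_mem_slitPlane)).isPreconnected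
  -- Identity theorem: the formula is known on the positive axis, and the points `1 + 1/(n+1)`
  -- accumulate at `1`.
  refine hA.eqOn_of_preconnected_of_frequently_eq hB hpre (z₀ := 1) (by simp) ?_ hw
  have h1 : Tendsto (fun n : ℕ => ((1 + 1 / ((n : ℝ) + 1) : ℝ) : ℂ)) atTop (𝓝[≠] 1) := by
    refine tendsto_nhdsWithin_iff.2 ⟨?_, Eventually.of_forall fun n => ?_⟩
    · have := (tendsto_one_div_add_atTop_nhds_zero_nat (𝕜 := ℝ)).const_add 1
      rw [add_zero] at this
      exact (Complex.continuous_ofReal.tendsto 1).comp this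
    · simp only [Set.mem_compl_iff, Set.mem_singleton_iff]
      have : (0 : ℝ) < 1 / ((n : ℝ) + 1) := by positivity
      intro h
      rw [← Complex.ofReal_one, Complex.ofReal_inj] at h
      linarith
  refine h1.frequently (Frequently.of_forall fun n => ?_)
  exact integral_cpow_neg_div_add_ofReal hx0 hx1 (by positivity)

/-! ### Mellin transform of the Hadamard series -/

/-- Tonelli for the norms. Integrability of the sum itself is needed for the integration by parts
below. -/
lemma integrable_of_hasSum_of_summable_integral_norm {X E : Type*} [MeasurableSpace X]
    {μ : Measure X} [NormedAddCommGroup E] {F : ℕ → X → E} {f : X → E}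
    (hF : ∀ n, Integrable (F n) μ) (hsum : Summable fun n => ∫ x, ‖F n x‖ ∂μ)
    (hf : AEStronglyMeasurable f μ) (hfF : ∀ᵐ x ∂μ, HasSum (fun n => F n x) (f x)) :
    Integrable f μ := by
  refine ⟨hf, ?_⟩
  rw [hasFiniteIntegral_iff_enorm]
  calc ∫⁻ x, ‖f x‖ₑ ∂μ ≤ ∫⁻ x, ∑' n, ‖F n x‖ₑ ∂μ := by
        refine lintegral_mono_ae ?_
        filter_upwards [hfF] with x hx
        rw [← hx.tsum_eq]
        exact enorm_tsum_le_tsum_enorm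
    _ = ∑' n, ∫⁻ x, ‖F n x‖ₑ ∂μ := lintegral_tsum fun n => (hF n).1.enorm
    _ = ∑' n, ENNReal.ofReal (∫ x, ‖F n x‖ ∂μ) := by
        congr 1
        funext n
        rw [ofReal_integral_norm_eq_lintegral_enorm (hF n)]
    _ < ⊤ := hsum.tsum_ofReal_lt_top

/-- Replacing `s` by `s - q` reduces the genus `q` term to the case `q = 0`; the sign `(-1) ^ q` is
later absorbed by `sin (π (s - q))`. -/
lemma cpow_neg_mul_pow_div {s w : ℂ} (hw : w ≠ 0) (q : ℕ) {r : ℝ} (hr : 0 < r) :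
    (r : ℂ) ^ (-s) * ((-r / w) ^ q / (r + w)) =
      ((-1) ^ q * (w ^ q)⁻¹) * ((r : ℂ) ^ (-(s - q)) / (r + w)) := by
  have hrc : (r : ℂ) ≠ 0 := by exact_mod_cast hr.ne'
  rw [show -(s - q) = -s + q by ring, Complex.cpow_add _ _ hrc, Complex.cpow_natCast, div_pow,
    neg_pow]
  field_simp

lemma sin_pi_mul_sub_natCast (s : ℂ) (q : ℕ) :
    Complex.sin (Real.pi * (s - q)) = (-1) ^ q * Complex.sin (Real.pi * s) := by
  rw [mul_sub, mul_comm (Real.pi : ℂ) (q : ℂ)]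
  simpa using Complex.sin_antiperiodic.sub_nat_mul_eq q (x := (Real.pi : ℂ) * s)

lemma integral_cpow_neg_mul_pow_div {s w : ℂ} {q : ℕ} (hq : (q : ℝ) < s.re) (hs : s.re < q + 1)
    (hw : w ∈ Complex.slitPlane) :
    ∫ r in Set.Ioi (0 : ℝ), (r : ℂ) ^ (-s) * ((-r / w) ^ q / (r + w)) =
      w ^ (-s) * (Real.pi / Complex.sin (Real.pi * s)) := by
  have hw0 := Complex.slitPlane_ne_zero hw
  rw [setIntegral_congr_fun measurableSet_Ioi fun r hr => cpow_neg_mul_pow_div hw0 q hr,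
    integral_const_mul, integral_cpow_neg_div_add (by simpa using hq)
      (by simp only [Complex.sub_re, Complex.natCast_re]; linarith) hw, sin_pi_mul_sub_natCast,
    show -(s - q) = -s + q by ring, Complex.cpow_add _ _ hw0, Complex.cpow_natCast]
  have h1 : ((-1 : ℂ)) ^ q ≠ 0 := by simp
  have h2 : w ^ q ≠ 0 := pow_ne_zero _ hw0
  field_simp

lemma integral_rpow_neg_div_add {σ t : ℝ} (hσ0 : 0 < σ) (hσ1 : σ < 1) (ht : 0 < t) :
    ∫ r in Set.Ioi (0 : ℝ), r ^ (-σ) / (r + t) =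
      t ^ (-σ) * (Real.pi / Real.sin (Real.pi * σ)) := by
  have h := integral_cpow_neg_div_add_ofReal (x := (σ : ℂ)) (by simpa using hσ0)
    (by simpa using hσ1) ht
  have h2 : ∫ r in Set.Ioi (0 : ℝ), (r : ℂ) ^ (-(σ : ℂ)) / (r + t) =
      ∫ r in Set.Ioi (0 : ℝ), ((r ^ (-σ) / (r + t) : ℝ) : ℂ) := by
    refine setIntegral_congr_fun measurableSet_Ioi fun r hr => ?_
    have hr0 : 0 < r := hr
    rw [← Complex.ofReal_neg, ← Complex.ofReal_cpow hr0.le]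
    push_cast
    rfl
  rw [h2, integral_complex_ofReal, ← Complex.ofReal_neg, ← Complex.ofReal_cpow ht.le] at h
  exact_mod_cast h

/-- Termwise Mellin transform of a sum of simple fractions. -/
lemma hasSum_integral_cpow_neg_mul {w : ℕ → ℂ} (hw : ∀ n, w n ∈ Complex.slitPlane) {c : ℝ}
    (hc : 0 < c) (hcw : ∀ n, ∀ r : ℝ, 0 ≤ r → c * (r + ‖w n‖) ≤ ‖(r : ℂ) + w n‖) {q : ℕ} {s : ℂ}
    (hq : (q : ℝ) < s.re) (hs : s.re < q + 1) (hsum : Summable fun n => ‖w n‖ ^ (-s.re))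
    {D : ℝ → ℂ} (hD : ∀ r : ℝ, 0 < r → HasSum (fun n => (-r / w n) ^ q / (r + w n)) (D r))
    (hDc : ContinuousOn D (Set.Ioi 0)) :
    IntegrableOn (fun r : ℝ => (r : ℂ) ^ (-s) * D r) (Set.Ioi 0) ∧
    HasSum (fun n => w n ^ (-s) * (Real.pi / Complex.sin (Real.pi * s)))
      (∫ r in Set.Ioi (0 : ℝ), (r : ℂ) ^ (-s) * D r) := by
  set F : ℕ → ℝ → ℂ := fun n r => (r : ℂ) ^ (-s) * ((-r / w n) ^ q / (r + w n)) with hF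
  have hw0 : ∀ n, w n ≠ 0 := fun n => Complex.slitPlane_ne_zero (hw n)
  have hx0 : 0 < (s - q).re := by simpa using hq
  have hx1 : (s - q).re < 1 := by simp only [Complex.sub_re, Complex.natCast_re]; linarith
  have hFint : ∀ n, Integrable (F n) (volume.restrict (Set.Ioi 0)) := by
    intro n
    have h1 := (integrableOn_cpow_neg_div_add hx0 hx1 (hw n)).const_mul
      ((-1) ^ q * (w n ^ q)⁻¹)
    exact IntegrableOn.congr_fun h1 (fun r hr => (cpow_neg_mul_pow_div (hw0 n) q hr).symm)
      measurableSet_Ioi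
  -- The uniform lower bound `hcw` compares each norm with a real Stieltjes integral, which equals a
  -- constant times `‖w n‖ ^ (-s.re)`.
  have hFsum : Summable fun n => ∫ r in Set.Ioi (0 : ℝ), ‖F n r‖ := by
    refine Summable.of_nonneg_of_le (fun n => integral_nonneg fun r => norm_nonneg _)
      (fun n => ?_) (hsum.mul_left (c⁻¹ * (Real.pi / Real.sin (Real.pi * (s - q).re))))
    have hn : 0 < ‖w n‖ := norm_pos_iff.2 (hw0 n)
    calc ∫ r in Set.Ioi (0 : ℝ), ‖F n r‖
        ≤ ∫ r in Set.Ioi (0 : ℝ), (c⁻¹ * (‖w n‖ ^ q)⁻¹) * (r ^ (-(s - q).re) / (r + ‖w n‖)) := by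
          refine setIntegral_mono_on (hFint n).norm
            ((integrableOn_rpow_neg_div_add hx0 hx1 hn).const_mul _) measurableSet_Ioi
            fun r hr => ?_
          have hr0 : 0 < r := hr
          simp only [hF]
          rw [cpow_neg_mul_pow_div (hw0 n) q hr, norm_mul, norm_mul, norm_pow, norm_neg, norm_one,
            one_pow, one_mul, norm_inv, norm_pow, norm_div,
            Complex.norm_cpow_eq_rpow_re_of_pos hr0, Complex.neg_re, mul_comm c⁻¹, mul_assoc]
          refine mul_le_mul_of_nonneg_left ?_ (by positivity)
          calc r ^ (-(s - q).re) / ‖(r : ℂ) + w n‖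
              ≤ r ^ (-(s - q).re) / (c * (r + ‖w n‖)) := by
                gcongr
                exact hcw n r hr0.le
            _ = _ := by field_simp
      _ = _ := by
          rw [integral_const_mul, integral_rpow_neg_div_add hx0 hx1 hn]
          have : ‖w n‖ ^ (-(s - q).re) = ‖w n‖ ^ (-s.re) * ‖w n‖ ^ q := by
            rw [← Real.rpow_natCast, ← Real.rpow_add hn]
            congr 1
            simp only [Complex.sub_re, Complex.natCast_re]
            ring
          rw [this]
          field_simp
  have hFD : ∀ r ∈ Set.Ioi (0 : ℝ), HasSum (fun n => F n r) ((r : ℂ) ^ (-s) * D r) :=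
    fun r hr => (hD r hr).mul_left _
  have hmeas : AEStronglyMeasurable (fun r : ℝ => (r : ℂ) ^ (-s) * D r)
      (volume.restrict (Set.Ioi 0)) :=
    (by fun_prop : Measurable fun r : ℝ => (r : ℂ) ^ (-s)).aestronglyMeasurable.mul
      (hDc.aestronglyMeasurable measurableSet_Ioi)
  refine ⟨integrable_of_hasSum_of_summable_integral_norm hFint hFsum hmeas
    ((ae_restrict_iff' measurableSet_Ioi).2 (Eventually.of_forall hFD)), ?_⟩
  have := hasSum_integral_of_summable_integral_norm hFint hFsum
  simp only [hF, integral_cpow_neg_mul_pow_div hq hs (hw _)] at this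
  rwa [setIntegral_congr_fun measurableSet_Ioi fun r hr => (hFD r hr).tsum_eq] at this

/-- The zeta function of `w` as a Mellin transform of the logarithm of its characteristic
function. -/
theorem hasSum_cpow_neg {w : ℕ → ℂ} (hw : ∀ n, w n ∈ Complex.slitPlane) {c : ℝ}
    (hc : 0 < c) (hcw : ∀ n, ∀ r : ℝ, 0 ≤ r → c * (r + ‖w n‖) ≤ ‖(r : ℂ) + w n‖) {q : ℕ} {s : ℂ}
    (hq : (q : ℝ) < s.re) (hs : s.re < q + 1) (hsum : Summable fun n => ‖w n‖ ^ (-s.re))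
    {g D : ℝ → ℂ} (hg : ∀ r : ℝ, 0 < r → HasDerivAt g (D r) r)
    (hD : ∀ r : ℝ, 0 < r → HasSum (fun n => (-r / w n) ^ q / (r + w n)) (D r))
    (hDc : ContinuousOn D (Set.Ioi 0)) {b : ℝ} (hb : b < s.re)
    (h0 : g =O[𝓝[>] 0] fun r : ℝ => r ^ ((q : ℝ) + 1)) (hinf : g =O[atTop] fun r : ℝ => r ^ b) :
    HasSum (fun n => w n ^ (-s))
      (s * Complex.sin (Real.pi * s) / Real.pi * mellin g (-s)) := by
  obtain ⟨hint, hS⟩ := hasSum_integral_cpow_neg_mul hw hc hcw hq hs hsum hD hDc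
  have hs0 : s ≠ 0 := by
    rintro rfl
    simp only [Complex.zero_re] at hq
    have : (0 : ℝ) ≤ q := Nat.cast_nonneg q
    linarith
  -- `Re s` lies strictly between consecutive integers, so `s` is not an integer.
  have hsin : Complex.sin (Real.pi * s) ≠ 0 := by
    intro h
    obtain ⟨k, hk⟩ := Complex.sin_eq_zero_iff.1 h
    rw [mul_comm] at hk
    have hk' := mul_right_cancel₀ (by exact_mod_cast Real.pi_ne_zero) hk
    have h1 : s.re = (k : ℝ) := by rw [hk']; simp
    rw [h1] at hq hs
    have h2 : (q : ℤ) < k := by exact_mod_cast hq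
    have h3 : k < (q : ℤ) + 1 := by exact_mod_cast hs
    omega
  have hgc : ContinuousOn g (Set.Ioi 0) := fun r hr => (hg r hr).continuousAt.continuousWithinAt
  have hconv : MellinConvergent g (-s) :=
    mellinConvergent_of_isBigO_rpow (a := -b) (b := -((q : ℝ) + 1))
      (hgc.locallyIntegrableOn measurableSet_Ioi) (by simpa using hinf) (by simpa using hb)
      (by simpa using h0) (by simpa using hs)
  have hnorm : ∀ r : ℝ, 0 < r → ‖(r : ℂ) ^ (-s) / (-s)‖ = r ^ (-s.re) / ‖s‖ := by
    intro r hr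
    rw [norm_div, norm_neg, Complex.norm_cpow_eq_rpow_re_of_pos hr, Complex.neg_re]
  -- The boundary terms `r ^ (-s) g(r)` vanish: at `0` since `g = O(r ^ (q + 1))` and `Re s < q +
  -- 1`, at infinity since `g = O(r ^ b)` and `b < Re s`.
  have hparts := integral_Ioi_mul_deriv_eq_deriv_mul (a := 0) (a' := (0 : ℂ)) (b' := 0)
    (u := fun r : ℝ => (r : ℂ) ^ (-s) / (-s)) (u' := fun r : ℝ => (r : ℂ) ^ (-s - 1))
    (v := g) (v' := D) (fun r hr => by
      have := (hasDerivAt_ofReal_cpow_const' (x := r) (r := -s - 1) (ne_of_gt hr)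
        (fun h => hs0 (by linear_combination -h)))
      simpa only [sub_add_cancel] using this) hg
    (by
      refine IntegrableOn.congr_fun (hint.div_const (-s)) (fun r _ => ?_) measurableSet_Ioi
      simp only [Pi.mul_apply]
      ring)
    hconv ?_ ?_
  · have h1 : ∫ r in Set.Ioi (0 : ℝ), (r : ℂ) ^ (-s) / (-s) * D r =
        -(1 / s) * ∫ r in Set.Ioi (0 : ℝ), (r : ℂ) ^ (-s) * D r := by
      rw [← integral_const_mul]
      refine setIntegral_congr_fun measurableSet_Ioi fun r _ => ?_
      field_simp
    have hm : mellin g (-s) = (1 / s) * ∫ r in Set.Ioi (0 : ℝ), (r : ℂ) ^ (-s) * D r := by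
      rw [h1] at hparts
      simp only [mellin, smul_eq_mul]
      linear_combination hparts
    rw [hm]
    have hpi : (Real.pi : ℂ) ≠ 0 := by exact_mod_cast Real.pi_ne_zero
    have h2 := hS.mul_right (Complex.sin (Real.pi * s) / Real.pi)
    have h3 : ∀ n, w n ^ (-s) * (Real.pi / Complex.sin (Real.pi * s)) *
        (Complex.sin (Real.pi * s) / Real.pi) = w n ^ (-s) := by
      intro n
      rw [mul_assoc, div_mul_div_cancel₀ hsin, div_self hpi, mul_one]
    have h4 : ∀ I : ℂ, s * Complex.sin (Real.pi * s) / Real.pi * (1 / s * I) =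
        I * (Complex.sin (Real.pi * s) / Real.pi) := by
      intro I
      field_simp
    rw [h4]
    simpa only [h3] using h2
  · rw [tendsto_zero_iff_norm_tendsto_zero]
    obtain ⟨C, hC⟩ := h0.bound
    refine squeeze_zero' (g := fun r : ℝ => C / ‖s‖ * r ^ ((q : ℝ) + 1 - s.re))
      (Eventually.of_forall fun r => norm_nonneg _) ?_ ?_
    · filter_upwards [hC, self_mem_nhdsWithin] with r hr hr0
      have hr0 : 0 < r := hr0
      rw [Pi.mul_apply, norm_mul, hnorm r hr0, Real.rpow_sub hr0, Real.rpow_neg hr0.le]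
      rw [Real.norm_of_nonneg (by positivity)] at hr
      calc (r ^ s.re)⁻¹ / ‖s‖ * ‖g r‖ ≤ (r ^ s.re)⁻¹ / ‖s‖ * (C * r ^ ((q : ℝ) + 1)) := by gcongr
        _ = _ := by ring
    · have : Tendsto (fun r : ℝ => r ^ ((q : ℝ) + 1 - s.re)) (𝓝[>] 0) (𝓝 0) := by
        have h := (Real.continuousAt_rpow_const 0 ((q : ℝ) + 1 - s.re)
          (Or.inr (by linarith))).tendsto
        rw [Real.zero_rpow (by linarith)] at h
        exact h.mono_left nhdsWithin_le_nhds
      simpa using this.const_mul (C / ‖s‖)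
  · rw [tendsto_zero_iff_norm_tendsto_zero]
    obtain ⟨C, hC⟩ := hinf.bound
    refine squeeze_zero' (g := fun r : ℝ => C / ‖s‖ * r ^ (-(s.re - b)))
      (Eventually.of_forall fun r => norm_nonneg _) ?_ ?_
    · filter_upwards [hC, eventually_gt_atTop 0] with r hr hr0
      rw [Pi.mul_apply, norm_mul, hnorm r hr0, neg_sub, Real.rpow_sub hr0, Real.rpow_neg hr0.le]
      rw [Real.norm_of_nonneg (by positivity)] at hr
      calc (r ^ s.re)⁻¹ / ‖s‖ * ‖g r‖ ≤ (r ^ s.re)⁻¹ / ‖s‖ * (C * r ^ b) := by gcongr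
        _ = _ := by ring
    · simpa using (tendsto_rpow_neg_atTop (y := s.re - b) (by linarith)).const_mul (C / ‖s‖)

/-! ### Continuation of Mellin transforms from behaviour at infinity -/

lemma locallyIntegrableOn_indicator {f : ℝ → ℂ} (hf : ContinuousOn f (Set.Ioi 0)) {S : Set ℝ}
    (hS : MeasurableSet S) : LocallyIntegrableOn (S.indicator f) (Set.Ioi 0) := by
  intro x hx
  obtain ⟨t, ht, hi⟩ := hf.locallyIntegrableOn (μ := volume) measurableSet_Ioi x hx
  exact ⟨t, ht, Integrable.indicator hi hS⟩

lemma indicator_Ioi_eventuallyEq (f : ℝ → ℂ) : (Set.Ioi 1).indicator f =ᶠ[atTop] f := by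
  filter_upwards [eventually_gt_atTop 1] with r hr
  exact Set.indicator_of_mem hr f

lemma indicator_Ioi_isBigO (f : ℝ → ℂ) (b : ℝ) :
    (Set.Ioi 1).indicator f =O[𝓝[>] 0] fun r : ℝ => r ^ b := by
  refine IsBigO.congr' (isBigO_zero _ _) ?_ EventuallyEq.rfl
  have : Set.Ioo (0 : ℝ) 1 ∈ 𝓝[>] (0 : ℝ) := Ioo_mem_nhdsGT one_pos
  filter_upwards [this] with r hr
  rw [Set.indicator_of_notMem]
  simpa using hr.2.le

lemma mellinConvergent_indicator_Ioi {f : ℝ → ℂ} (hf : ContinuousOn f (Set.Ioi 0)) {b : ℝ}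
    (hO : f =O[atTop] fun r : ℝ => r ^ b) {s : ℂ} (hs : b < s.re) :
    MellinConvergent ((Set.Ioi 1).indicator f) (-s) :=
  mellinConvergent_of_isBigO_rpow (a := -b) (b := (-s).re - 1)
    (locallyIntegrableOn_indicator hf measurableSet_Ioi)
    (hO.congr' (indicator_Ioi_eventuallyEq f).symm (by simp)) (by simpa using hs)
    (indicator_Ioi_isBigO f _) (by linarith)

lemma differentiableAt_mellin_indicator_Ioi {f : ℝ → ℂ} (hf : ContinuousOn f (Set.Ioi 0)) {b : ℝ}
    (hO : f =O[atTop] fun r : ℝ => r ^ b) {s : ℂ} (hs : b < s.re) :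
    DifferentiableAt ℂ (fun s => mellin ((Set.Ioi 1).indicator f) (-s)) s := by
  have := mellin_differentiableAt_of_isBigO_rpow (a := -b) (b := (-s).re - 1) (s := -s)
    (locallyIntegrableOn_indicator hf measurableSet_Ioi)
    (hO.congr' (indicator_Ioi_eventuallyEq f).symm (by simp)) (by simpa using hs)
    (indicator_Ioi_isBigO f _) (by linarith)
  exact this.comp s differentiable_neg.differentiableAt

/-- The Mellin transform of the part of `f` on `(1, ∞)`, convergent for `Re s > α`, continues
to a neighbourhood of `Re s ≥ 0` with principal part `κ₀ / s + κ₁ / s ^ 2` at `0`. -/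
structure HasTail (α : ℝ) (f : ℝ → ℂ) (κ₀ κ₁ : ℂ) : Prop where
  continuousOn : ContinuousOn f (Set.Ioi 0)
  isBigO : ∀ b : ℝ, α < b → f =O[atTop] fun r : ℝ => r ^ b
  continuation : ∃ η : ℝ, 0 < η ∧ ∃ P : ℂ → ℂ, MeromorphicOn P {s : ℂ | -η < s.re} ∧
    AnalyticAt ℂ P 0 ∧ ∀ s : ℂ, α < s.re →
      mellin ((Set.Ioi 1).indicator f) (-s) = P s + κ₀ / s + κ₁ / s ^ 2

lemma HasTail.mellinConvergent {α : ℝ} {f : ℝ → ℂ} {κ₀ κ₁ : ℂ} (h : HasTail α f κ₀ κ₁) {s : ℂ}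
    (hs : α < s.re) : MellinConvergent ((Set.Ioi 1).indicator f) (-s) := by
  obtain ⟨b, hb, hb'⟩ := exists_between hs
  exact mellinConvergent_indicator_Ioi h.continuousOn (h.isBigO b hb) hb'

lemma HasTail.add {α : ℝ} {f g : ℝ → ℂ} {κ₀ κ₁ κ₀' κ₁' : ℂ} (hf : HasTail α f κ₀ κ₁)
    (hg : HasTail α g κ₀' κ₁') : HasTail α (fun r => f r + g r) (κ₀ + κ₀') (κ₁ + κ₁') := by
  obtain ⟨η, hη, P, hP, hP0, hPf⟩ := hf.continuation
  obtain ⟨η', hη', P', hP', hP0', hPf'⟩ := hg.continuation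
  refine ⟨hf.continuousOn.add hg.continuousOn, fun b hb => (hf.isBigO b hb).add (hg.isBigO b hb),
    min η η', lt_min hη hη', fun s => P s + P' s, ?_, hP0.add hP0', fun s hs => ?_⟩
  · intro s hs
    have hs' : -min η η' < s.re := hs
    exact (hP s (show -η < s.re by linarith [min_le_left η η'])).add
      (hP' s (show -η' < s.re by linarith [min_le_right η η']))
  · have h1 := (hasMellin_add (hf.mellinConvergent hs) (hg.mellinConvergent hs)).2
    rw [hPf s hs, hPf' s hs] at h1
    have h2 : (Set.Ioi 1).indicator (fun r => f r + g r) =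
        fun t => (Set.Ioi 1).indicator f t + (Set.Ioi 1).indicator g t := by
      funext t
      exact Set.indicator_add' _ f g ▸ rfl
    rw [h2, h1]
    ring

lemma HasTail.const_mul {α : ℝ} {f : ℝ → ℂ} {κ₀ κ₁ : ℂ} (hf : HasTail α f κ₀ κ₁) (x : ℂ) :
    HasTail α (fun r => x * f r) (x * κ₀) (x * κ₁) := by
  obtain ⟨η, hη, P, hP, hP0, hPf⟩ := hf.continuation
  refine ⟨continuousOn_const.mul hf.continuousOn, fun b hb => (hf.isBigO b hb).const_mul_left x,
    η, hη, fun s => x * P s, fun s hs => (MeromorphicAt.const x s).mul (hP s hs),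
    analyticAt_const.mul hP0, fun s hs => ?_⟩
  have h2 : (Set.Ioi 1).indicator (fun r => x * f r) =
      fun t => x • (Set.Ioi 1).indicator f t := by
    funext t
    simp [Set.indicator_apply]
  rw [h2, mellin_const_smul, hPf s hs, smul_eq_mul]
  ring

lemma HasTail.congr {α : ℝ} {f g : ℝ → ℂ} {κ₀ κ₁ : ℂ} (hf : HasTail α f κ₀ κ₁)
    (h : ∀ r : ℝ, 0 < r → f r = g r) : HasTail α g κ₀ κ₁ := by
  obtain ⟨η, hη, P, hP, hP0, hPf⟩ := hf.continuation
  refine ⟨hf.continuousOn.congr fun r hr => (h r hr).symm, fun b hb => (hf.isBigO b hb).congr' ?_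
    EventuallyEq.rfl, η, hη, P, hP, hP0, fun s hs => ?_⟩
  · filter_upwards [eventually_gt_atTop 0] with r hr using h r hr
  · rw [← hPf s hs]
    congr 1
    exact Set.indicator_congr fun r hr => (h r (one_pos.trans hr)).symm

/-- The Mellin integral already converges and is holomorphic for `Re s > -η`, so it is its own
continuation and has no principal part. -/
lemma hasTail_of_isBigO {α : ℝ} (hα : 0 ≤ α) {f : ℝ → ℂ} (hf : ContinuousOn f (Set.Ioi 0)) {η : ℝ}
    (hη : 0 < η) (hO : f =O[atTop] fun r : ℝ => r ^ (-η)) : HasTail α f 0 0 := by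
  have hd : ∀ s : ℂ, -η < s.re →
      AnalyticAt ℂ (fun s => mellin ((Set.Ioi 1).indicator f) (-s)) s := by
    intro s hs
    have ho : IsOpen {s : ℂ | -η < s.re} := isOpen_lt continuous_const Complex.continuous_re
    exact DifferentiableOn.analyticAt (s := {s : ℂ | -η < s.re}) (fun z hz =>
      (differentiableAt_mellin_indicator_Ioi hf hO hz).differentiableWithinAt) (ho.mem_nhds hs)
  refine ⟨hf, fun b hb => hO.trans ?_, η, hη, _, fun s hs => (hd s hs).meromorphicAt,
    hd 0 (by simpa using hη), fun s _ => by simp⟩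
  refine IsBigO.of_bound 1 ?_
  filter_upwards [eventually_ge_atTop 1] with r hr
  rw [Real.norm_of_nonneg (by positivity), Real.norm_of_nonneg (by positivity), one_mul]
  exact Real.rpow_le_rpow_of_exponent_le hr (by linarith)

lemma isBigO_ofReal_rpow {β b : ℝ} (h : β ≤ b) :
    (fun r : ℝ => ((r ^ β : ℝ) : ℂ)) =O[atTop] fun r : ℝ => r ^ b := by
  refine IsBigO.of_bound 1 ?_
  filter_upwards [eventually_ge_atTop 1] with r hr
  rw [Complex.norm_real, Real.norm_of_nonneg (by positivity), Real.norm_of_nonneg (by positivity),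
    one_mul]
  exact Real.rpow_le_rpow_of_exponent_le hr h

lemma continuousOn_ofReal_rpow (β : ℝ) :
    ContinuousOn (fun r : ℝ => ((r ^ β : ℝ) : ℂ)) (Set.Ioi 0) := fun r hr =>
  (Complex.continuous_ofReal.continuousAt.comp
    (Real.continuousAt_rpow_const r β (Or.inl (ne_of_gt hr)))).continuousWithinAt

lemma mellin_indicator_rpow {β : ℝ} {s : ℂ} (hs : β < -s.re) :
    mellin ((Set.Ioi 1).indicator fun r : ℝ => ((r ^ β : ℝ) : ℂ)) s = -1 / (s + β) := by
  have h1 : ∀ r ∈ Set.Ioi (0 : ℝ),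
      (r : ℂ) ^ (s - 1) • (Set.Ioi 1).indicator (fun r : ℝ => ((r ^ β : ℝ) : ℂ)) r =
      (Set.Ioi 1).indicator (fun r : ℝ => (r : ℂ) ^ (s + β - 1)) r := by
    intro r hr
    have hr0 : (0 : ℝ) < r := hr
    by_cases h : r ∈ Set.Ioi (1 : ℝ)
    · rw [Set.indicator_of_mem h, Set.indicator_of_mem h, Complex.ofReal_cpow hr0.le, smul_eq_mul,
        ← Complex.cpow_add _ _ (by exact_mod_cast hr0.ne')]
      ring_nf
    · rw [Set.indicator_of_notMem h, Set.indicator_of_notMem h, smul_zero]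
  rw [mellin, setIntegral_congr_fun measurableSet_Ioi h1, setIntegral_indicator measurableSet_Ioi,
    Set.inter_eq_right.2 (Set.Ioi_subset_Ioi zero_le_one), integral_Ioi_cpow_of_lt _ one_pos]
  · simp
  · simp only [Complex.sub_re, Complex.add_re, Complex.ofReal_re, Complex.one_re]
    linarith

/-- Differentiating a Mellin transform in `s` inserts a factor `log r`, so this is the derivative of
`-1 / (s + β)`. -/
lemma mellin_indicator_rpow_mul_log {β : ℝ} {s : ℂ} (hs : β < -s.re) :
    mellin ((Set.Ioi 1).indicator fun r : ℝ => ((r ^ β : ℝ) : ℂ) * Real.log r) s =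
      1 / (s + β) ^ 2 := by
  have h1 := (mellin_hasDerivAt_of_isBigO_rpow (a := -β) (b := s.re - 1) (s := s)
    (locallyIntegrableOn_indicator (continuousOn_ofReal_rpow β) measurableSet_Ioi)
    ((isBigO_ofReal_rpow (b := - -β) (by simp)).congr' (indicator_Ioi_eventuallyEq _).symm
      EventuallyEq.rfl) (by linarith) (indicator_Ioi_isBigO _ _) (by linarith)).2
  have hne : s + β ≠ 0 := by
    intro h
    have := congrArg Complex.re h
    simp at this
    linarith
  have h2 : HasDerivAt (fun s : ℂ => -1 / (s + β)) (1 / (s + β) ^ 2) s := by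
    have := (((hasDerivAt_id s).add_const (β : ℂ)).inv hne).const_mul (-1)
    simp only [id] at this
    convert! this using 1
    ring
  have h3 : mellin ((Set.Ioi 1).indicator fun r : ℝ => ((r ^ β : ℝ) : ℂ)) =ᶠ[𝓝 s]
      fun s : ℂ => -1 / (s + β) := by
    have ho : IsOpen {s : ℂ | β < -s.re} := isOpen_lt continuous_const (by fun_prop)
    filter_upwards [ho.mem_nhds hs] with z hz using mellin_indicator_rpow hz
  rw [← h1.unique (h2.congr_of_eventuallyEq h3)]
  congr 1
  funext r
  simp only [Set.indicator_apply]
  split_ifs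
  · rw [Complex.real_smul, mul_comm]
  · simp

/-- The transform at `-s` is `1 / (s - β)`: for `β = 0` it is the principal part at `0`, and for `β
≠ 0` it is analytic at `0` and goes into `P`. -/
lemma hasTail_rpow {α β : ℝ} (h : β ≤ α) :
    HasTail α (fun r : ℝ => ((r ^ β : ℝ) : ℂ)) (if β = 0 then 1 else 0) 0 := by
  refine ⟨continuousOn_ofReal_rpow β, fun b hb => isBigO_ofReal_rpow (h.trans hb.le), 1, one_pos,
    if β = 0 then 0 else fun s => 1 / (s - β), ?_, ?_, fun s hs => ?_⟩
  · intro s _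
    split_ifs
    · exact analyticAt_const.meromorphicAt
    · fun_prop
  · split_ifs with h0
    · exact analyticAt_const
    · exact analyticAt_const.div (by fun_prop) (by simpa using h0)
  · rw [mellin_indicator_rpow (by simpa using h.trans_lt hs)]
    have : -1 / (-s + β) = 1 / (s - β) := by
      rw [show -s + (β : ℂ) = -(s - β) by ring, neg_div_neg_eq]
    rw [this]
    split_ifs with h0
    · simp [h0]
    · simp

lemma hasTail_rpow_mul_log {α β : ℝ} (h : β ≤ α) :
    HasTail α (fun r : ℝ => ((r ^ β : ℝ) : ℂ) * Real.log r) 0 (if β = 0 then 1 else 0) := by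
  refine ⟨(continuousOn_ofReal_rpow β).mul fun r hr => ?_, fun b hb => ?_, 1, one_pos,
    if β = 0 then 0 else fun s => 1 / (s - β) ^ 2, ?_, ?_, fun s hs => ?_⟩
  · exact (Complex.continuous_ofReal.continuousAt.comp
      (Real.continuousAt_log (ne_of_gt hr))).continuousWithinAt
  · have h1 := isBigO_rpow_top_log_smul (a := -β) (b := -b)
      (f := fun r : ℝ => ((r ^ β : ℝ) : ℂ)) (by linarith) (isBigO_ofReal_rpow (by simp))
    simp only [neg_neg] at h1
    refine h1.congr_left fun r => ?_
    rw [Complex.real_smul, mul_comm]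
  · intro s _
    split_ifs
    · exact analyticAt_const.meromorphicAt
    · fun_prop
  · split_ifs with h0
    · exact analyticAt_const
    · exact analyticAt_const.div (by fun_prop) (by simpa using h0)
  · rw [mellin_indicator_rpow_mul_log (by simpa using h.trans_lt hs)]
    have : (1 : ℂ) / (-s + β) ^ 2 = 1 / (s - β) ^ 2 := by
      rw [show -s + (β : ℂ) = -(s - β) by ring, neg_sq]
    rw [this]
    split_ifs with h0
    · simp [h0]
    · simp

/-- Continuation of the Mellin transform of a function that is small at `0` and has a tail. -/
lemma HasTail.exists_mellin_eq {α : ℝ} {f : ℝ → ℂ} {κ₀ κ₁ : ℂ} (h : HasTail α f κ₀ κ₁) {b : ℝ}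
    (hb : 0 < b) (h0 : f =O[𝓝[>] 0] fun r : ℝ => r ^ b) :
    ∃ η : ℝ, 0 < η ∧ ∃ P : ℂ → ℂ, MeromorphicOn P {s : ℂ | -η < s.re ∧ s.re < b} ∧
      AnalyticAt ℂ P 0 ∧ ∀ s : ℂ, α < s.re → s.re < b →
        mellin f (-s) = P s + κ₀ / s + κ₁ / s ^ 2 := by
  obtain ⟨η, hη, P, hP, hP0, hPf⟩ := h.continuation
  have hinf : ∀ c : ℝ, (Set.Ioc 0 1).indicator f =O[atTop] fun r : ℝ => r ^ c := by
    intro c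
    refine IsBigO.congr' (isBigO_zero _ _) ?_ EventuallyEq.rfl
    filter_upwards [eventually_gt_atTop 1] with r hr
    rw [Set.indicator_of_notMem]
    exact fun h => absurd h.2 (not_le.2 hr)
  have h0' : (Set.Ioc 0 1).indicator f =O[𝓝[>] 0] fun r : ℝ => r ^ (- -b) := by
    rw [neg_neg]
    refine h0.congr' ?_ EventuallyEq.rfl
    filter_upwards [Ioo_mem_nhdsGT (one_pos : (0 : ℝ) < 1)] with r hr
    rw [Set.indicator_of_mem (Set.mem_Ioc.2 ⟨hr.1, hr.2.le⟩)]
  have hloc := locallyIntegrableOn_indicator h.continuousOn (measurableSet_Ioc (a := 0) (b := 1))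
  -- On `(0, 1]` only the behaviour at `0` matters, so this half of the integral is holomorphic for
  -- `Re s < b` and contributes no pole.
  have hd : ∀ s : ℂ, s.re < b →
      AnalyticAt ℂ (fun s => mellin ((Set.Ioc 0 1).indicator f) (-s)) s := by
    intro s hs
    have ho : IsOpen {s : ℂ | s.re < b} := isOpen_lt Complex.continuous_re continuous_const
    refine DifferentiableOn.analyticAt (s := {s : ℂ | s.re < b}) (fun z hz => ?_)
      (ho.mem_nhds hs)
    have hz : z.re < b := hz
    have := mellin_differentiableAt_of_isBigO_rpow (a := (-z).re + 1) (s := -z) hloc (hinf _)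
      (by linarith) h0' (by simpa using hz)
    exact (this.comp z differentiable_neg.differentiableAt).differentiableWithinAt
  refine ⟨η, hη, fun s => mellin ((Set.Ioc 0 1).indicator f) (-s) + P s,
    fun s hs => (hd s hs.2).meromorphicAt.add (hP s hs.1), (hd 0 (by simpa using hb)).add hP0,
    fun s hs hsb => ?_⟩
  have hc1 : MellinConvergent ((Set.Ioc 0 1).indicator f) (-s) :=
    mellinConvergent_of_isBigO_rpow (a := (-s).re + 1) hloc (hinf _) (by linarith) h0'
      (by simpa using hsb)
  have h1 := (hasMellin_add hc1 (h.mellinConvergent hs)).2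
  rw [hPf s hs] at h1
  rw [add_assoc, add_assoc, ← add_assoc (P s), ← h1]
  refine setIntegral_congr_fun measurableSet_Ioi fun r hr => ?_
  have hr0 : (0 : ℝ) < r := hr
  by_cases h : r ≤ 1
  · simp [hr0, h, not_lt.2 h]
  · simp [h, not_le.1 h]

/-- `f` agrees up to a negative power of `r` with a function having a tail. -/
def HasTailMod (α : ℝ) (f : ℝ → ℂ) (κ₀ κ₁ : ℂ) : Prop :=
  ∃ E : ℝ → ℂ, HasTail α E κ₀ κ₁ ∧ ∃ η : ℝ, 0 < η ∧
    (fun r => f r - E r) =O[atTop] fun r : ℝ => r ^ (-η)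

lemma isBigO_rpow_rpow_atTop {a b : ℝ} (h : a ≤ b) :
    (fun r : ℝ => r ^ a) =O[atTop] fun r : ℝ => r ^ b := by
  refine IsBigO.of_bound 1 ?_
  filter_upwards [eventually_ge_atTop 1] with r hr
  rw [Real.norm_of_nonneg (by positivity), Real.norm_of_nonneg (by positivity), one_mul]
  exact Real.rpow_le_rpow_of_exponent_le hr h

lemma HasTail.hasTailMod {α : ℝ} {f : ℝ → ℂ} {κ₀ κ₁ : ℂ} (h : HasTail α f κ₀ κ₁) :
    HasTailMod α f κ₀ κ₁ :=
  ⟨f, h, 1, one_pos, by simpa using isBigO_zero _ _⟩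

lemma HasTailMod.add {α : ℝ} {f g : ℝ → ℂ} {κ₀ κ₁ κ₀' κ₁' : ℂ} (hf : HasTailMod α f κ₀ κ₁)
    (hg : HasTailMod α g κ₀' κ₁') :
    HasTailMod α (fun r => f r + g r) (κ₀ + κ₀') (κ₁ + κ₁') := by
  obtain ⟨E, hE, η, hη, hO⟩ := hf
  obtain ⟨E', hE', η', hη', hO'⟩ := hg
  refine ⟨_, hE.add hE', min η η', lt_min hη hη', ?_⟩
  have h1 := hO.trans (isBigO_rpow_rpow_atTop (neg_le_neg (min_le_left η η')))
  have h2 := hO'.trans (isBigO_rpow_rpow_atTop (neg_le_neg (min_le_right η η')))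
  exact (h1.add h2).congr_left fun r => by ring

lemma HasTailMod.const_mul {α : ℝ} {f : ℝ → ℂ} {κ₀ κ₁ : ℂ} (hf : HasTailMod α f κ₀ κ₁) (x : ℂ) :
    HasTailMod α (fun r => x * f r) (x * κ₀) (x * κ₁) := by
  obtain ⟨E, hE, η, hη, hO⟩ := hf
  exact ⟨_, hE.const_mul x, η, hη, (hO.const_mul_left x).congr_left fun r => by ring⟩

lemma HasTailMod.congr {α : ℝ} {f g : ℝ → ℂ} {κ₀ κ₁ : ℂ} (hf : HasTailMod α f κ₀ κ₁)
    (h : f =ᶠ[atTop] g) : HasTailMod α g κ₀ κ₁ := by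
  obtain ⟨E, hE, η, hη, hO⟩ := hf
  exact ⟨E, hE, η, hη, hO.congr' (h.mono fun r hr => by simp only [hr]) EventuallyEq.rfl⟩

lemma hasTailMod_of_isBigO {α : ℝ} (hα : 0 ≤ α) {f : ℝ → ℂ} {η : ℝ} (hη : 0 < η)
    (hO : f =O[atTop] fun r : ℝ => r ^ (-η)) : HasTailMod α f 0 0 :=
  ⟨fun _ => 0, hasTail_of_isBigO hα continuousOn_const hη (isBigO_zero _ _), η, hη,
    by simpa using hO⟩

lemma HasTailMod.sum {α : ℝ} (hα : 0 ≤ α) {ι : Type*} (s : Finset ι) {f : ι → ℝ → ℂ}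
    {κ₀ κ₁ : ι → ℂ} (h : ∀ i ∈ s, HasTailMod α (f i) (κ₀ i) (κ₁ i)) :
    HasTailMod α (fun r => ∑ i ∈ s, f i r) (∑ i ∈ s, κ₀ i) (∑ i ∈ s, κ₁ i) := by
  classical
  induction s using Finset.induction_on with
  | empty => simpa using hasTailMod_of_isBigO hα one_pos (isBigO_zero _ _)
  | insert k s hk ih =>
    simp only [Finset.sum_insert hk]
    exact (h k (by simp)).add (ih fun i hi => h i (Finset.mem_insert_of_mem hi))

/-- `f - E` is continuous on the half-line and decays like a negative power, hence has a tail
without principal part. `HasTailMod` itself sees `f` only near infinity, which is where the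
expansion is known. -/
lemma HasTailMod.hasTail {α : ℝ} (hα : 0 ≤ α) {f : ℝ → ℂ} {κ₀ κ₁ : ℂ}
    (h : HasTailMod α f κ₀ κ₁) (hf : ContinuousOn f (Set.Ioi 0)) : HasTail α f κ₀ κ₁ := by
  obtain ⟨E, hE, η, hη, hO⟩ := h
  have := hE.add (hasTail_of_isBigO hα (hf.sub hE.continuousOn) hη hO)
  simp only [add_zero] at this
  exact this.congr fun r _ => by simp

/-! ### Expansion of the shifted logarithm and the coefficients `Ω` -/

/-- The contribution of a power series `∑ x n u ^ n`, `u = -c / z`, multiplied by `z ^ β`, to the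
exponent `0`. -/
def constCoeff (c : ℂ) (β : ℝ) (x : ℕ → ℂ) : ℂ :=
  -- The test succeeds exactly when `β` is a natural number: for negative `β` the floor is `0`,
  -- which differs from `β`.
  if (⌊β⌋₊ : ℝ) = β then (-c) ^ ⌊β⌋₊ * x ⌊β⌋₊ else 0

lemma isBigO_sub_sum_of_hasSum {h : ℂ → ℂ} {x : ℕ → ℂ}
    (hs : ∀ u : ℂ, ‖u‖ < 1 → HasSum (fun n => x n * u ^ n) (h u)) (P : ℕ) :
    (fun u => h u - ∑ n ∈ Finset.range P, x n * u ^ n) =O[𝓝 0] fun u => ‖u‖ ^ P := by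
  have hp : HasFPowerSeriesAt h (FormalMultilinearSeries.ofScalars ℂ x) 0 := by
    rw [hasFPowerSeriesAt_iff]
    filter_upwards [Metric.ball_mem_nhds (0 : ℂ) one_pos] with u hu
    simpa [FormalMultilinearSeries.coeff_ofScalars, mul_comm] using hs u (by simpa using hu)
  have := hp.isBigO_sub_partialSum_pow P
  simpa [FormalMultilinearSeries.partialSum, FormalMultilinearSeries.coeff_ofScalars,
    mul_comm] using this

/-- The phase of `z ^ n` cancels that of `(-c / z) ^ n`, so the constant coefficient does not depend
on the direction `φ`. -/
lemma exp_mul_mul_neg_pow (c : ℂ) (φ : ℝ) (n : ℕ) :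
    Complex.exp ((n : ℂ) * (φ * Complex.I)) * (-(c * Complex.exp (-(φ * Complex.I)))) ^ n =
      (-c) ^ n := by
  rw [Complex.exp_nat_mul, ← mul_pow, Complex.exp_neg]
  congr 1
  have := Complex.exp_ne_zero (φ * Complex.I)
  field_simp

lemma tendsto_const_div_atTop (C : ℂ) : Tendsto (fun r : ℝ => C / r) atTop (𝓝 0) := by
  have h := (tendsto_inv_atTop_zero (𝕜 := ℝ))
  have h2 : Tendsto (fun r : ℝ => C * ((r⁻¹ : ℝ) : ℂ)) atTop (𝓝 (C * ((0 : ℝ) : ℂ))) :=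
    ((Complex.continuous_ofReal.tendsto 0).comp h).const_mul C
  simpa [div_eq_mul_inv] using h2

/-- Expansion at infinity of `z ^ β * h (-c / z)` and of `z ^ β * h (-c / z) * log |z|` along a
ray, for a function `h` given by a power series. -/
lemma hasTailMod_rpow_mul_series {α β : ℝ} (hα : 0 ≤ α) (hβ : β ≤ α) (c : ℂ) (φ : ℝ) {h : ℂ → ℂ}
    {x : ℕ → ℂ} (hs : ∀ u : ℂ, ‖u‖ < 1 → HasSum (fun n => x n * u ^ n) (h u)) :
    HasTailMod α (fun r => Complex.exp (β * (φ * Complex.I)) * ((r ^ β : ℝ) : ℂ) *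
      h (-(c * Complex.exp (-(φ * Complex.I))) / r)) (constCoeff c β x) 0 ∧
    HasTailMod α (fun r => Complex.exp (β * (φ * Complex.I)) * ((r ^ β : ℝ) : ℂ) *
      h (-(c * Complex.exp (-(φ * Complex.I))) / r) * Real.log r) 0 (constCoeff c β x) := by
  set e := Complex.exp (β * (φ * Complex.I)) with he
  set C := -(c * Complex.exp (-(φ * Complex.I))) with hC
  -- Enough terms that `β - P < 0`: the remainder, of order `r ^ (β - P)`, decays.
  set P : ℕ := ⌊β⌋₊ + 1 with hP
  have hPβ : β < P := by
    rw [hP]; push_cast; exact Nat.lt_floor_add_one β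
  have hK : ∑ n ∈ Finset.range P, e * x n * C ^ n * (if β - n = 0 then (1 : ℂ) else 0) =
      constCoeff c β x := by
    by_cases hb : (⌊β⌋₊ : ℝ) = β
    · rw [constCoeff, if_pos hb, Finset.sum_eq_single ⌊β⌋₊]
      · rw [if_pos (by linarith), mul_one, ← exp_mul_mul_neg_pow c φ ⌊β⌋₊, ← hC, he]
        have : ((⌊β⌋₊ : ℕ) : ℂ) = (β : ℂ) := by exact_mod_cast congrArg (Complex.ofReal) hb
        rw [this]
        ring
      · intro n _ hn
        rw [if_neg, mul_zero]
        intro h0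
        have : β = (n : ℝ) := by linarith
        apply hn
        rw [this, Nat.floor_natCast]
      · intro hn
        simp [hP] at hn
    · rw [constCoeff, if_neg hb]
      refine Finset.sum_eq_zero fun n _ => ?_
      rw [if_neg, mul_zero]
      intro h0
      apply hb
      have : β = (n : ℝ) := by linarith
      rw [this, Nat.floor_natCast]
  have hpow : ∀ r : ℝ, 0 < r → ∀ n : ℕ, ((r ^ (β - n) : ℝ) : ℂ) = ((r ^ β : ℝ) : ℂ) / (r : ℂ) ^ n := by
    intro r hr n
    rw [Real.rpow_sub hr, Real.rpow_natCast]
    push_cast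
    rfl
  have hrem : (fun r : ℝ => e * ((r ^ β : ℝ) : ℂ) * (h (C / r) -
      ∑ n ∈ Finset.range P, x n * (C / r) ^ n)) =O[atTop] fun r : ℝ => r ^ (-(P - β)) := by
    have h1 := (isBigO_sub_sum_of_hasSum hs P).comp_tendsto (tendsto_const_div_atTop C)
    have h2 : (fun r : ℝ => ‖C / (r : ℂ)‖ ^ P) =O[atTop] fun r : ℝ => r ^ (-(P : ℝ)) := by
      refine IsBigO.of_bound (‖C‖ ^ P) ?_
      filter_upwards [eventually_gt_atTop 0] with r hr
      rw [norm_pow, norm_norm, norm_div, Complex.norm_real, Real.norm_of_nonneg hr.le, div_pow,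
        Real.rpow_neg hr.le, Real.rpow_natCast, Real.norm_of_nonneg (by positivity)]
      rfl
    have h3 := ((isBigO_ofReal_rpow (le_refl β)).const_mul_left e).mul (h1.trans h2)
    refine h3.congr' EventuallyEq.rfl ?_
    filter_upwards [eventually_gt_atTop 0] with r hr
    rw [← Real.rpow_add hr]
    ring_nf
  have hsplit : ∀ r : ℝ, 0 < r → e * ((r ^ β : ℝ) : ℂ) * h (C / r) =
      (∑ n ∈ Finset.range P, e * x n * C ^ n * ((r ^ (β - n) : ℝ) : ℂ)) +
      e * ((r ^ β : ℝ) : ℂ) * (h (C / r) - ∑ n ∈ Finset.range P, x n * (C / r) ^ n) := by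
    intro r hr
    have : ∑ n ∈ Finset.range P, e * x n * C ^ n * ((r ^ (β - n) : ℝ) : ℂ) =
        e * ((r ^ β : ℝ) : ℂ) * ∑ n ∈ Finset.range P, x n * (C / r) ^ n := by
      rw [Finset.mul_sum]
      refine Finset.sum_congr rfl fun n _ => ?_
      rw [hpow r hr, div_pow]
      ring
    rw [this]
    ring
  constructor
  · have h1 := HasTailMod.sum hα (Finset.range P) fun n _ =>
      ((hasTail_rpow (α := α) (β := β - n)
        (by linarith [(Nat.cast_nonneg n : (0 : ℝ) ≤ n)])).const_mul (e * x n * C ^ n)).hasTailMod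
    have h2 := h1.add (hasTailMod_of_isBigO hα (by linarith) hrem)
    simp only [mul_zero, Finset.sum_const_zero, add_zero] at h2
    rw [hK] at h2
    refine h2.congr ?_
    filter_upwards [eventually_gt_atTop 0] with r hr using (hsplit r hr).symm
  · have h1 := HasTailMod.sum hα (Finset.range P) fun n _ =>
      ((hasTail_rpow_mul_log (α := α) (β := β - n)
        (by linarith [(Nat.cast_nonneg n : (0 : ℝ) ≤ n)])).const_mul (e * x n * C ^ n)).hasTailMod
    -- Half of the available decay is given up to absorb `log r`.
    have hlog := isBigO_rpow_top_log_smul (b := (P - β) / 2) (by linarith) hrem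
    have h2 := h1.add (hasTailMod_of_isBigO hα (by linarith) hlog)
    simp only [mul_zero, Finset.sum_const_zero, add_zero] at h2
    rw [hK] at h2
    refine h2.congr ?_
    filter_upwards [eventually_gt_atTop 0] with r hr
    rw [hsplit r hr, add_mul, Finset.sum_mul, Complex.real_smul]
    congr 1
    · exact Finset.sum_congr rfl fun n _ => by ring
    · ring

/-- Coefficients of `(1 + u) ^ β`. -/
def binomCoeff (β : ℝ) (n : ℕ) : ℂ := ((Ring.choose β n : ℝ) : ℂ)

/-- Coefficients of `log (1 + u)`. -/
def logCoeff (n : ℕ) : ℂ := (-1) ^ (n + 1) / n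

/-- Coefficients of `(1 + u) ^ β * log (1 + u)`. -/
def binomLogCoeff (β : ℝ) (n : ℕ) : ℂ :=
  ∑ p ∈ Finset.HasAntidiagonal.antidiagonal n, binomCoeff β p.1 * logCoeff p.2

lemma hasSum_binomCoeff (β : ℝ) {u : ℂ} (hu : ‖u‖ < 1) :
    HasSum (fun n => binomCoeff β n * u ^ n) ((1 + u) ^ (β : ℂ)) := by
  have h := (Complex.one_add_cpow_hasFPowerSeriesOnBall_zero (a := (β : ℂ))).hasSum (y := u)
    (by simpa [enorm_eq_nnnorm, ← NNReal.coe_lt_coe] using hu)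
  simp only [zero_add] at h
  convert! h using 2 with n
  simp [binomCoeff, binomialSeries, Complex.ofReal_choose, mul_comm]

lemma hasSum_logCoeff {u : ℂ} (hu : ‖u‖ < 1) :
    HasSum (fun n => logCoeff n * u ^ n) (Complex.log (1 + u)) := by
  convert! Complex.hasSum_taylorSeries_log hu using 2 with n
  rw [logCoeff]
  ring

lemma hasSum_binomLogCoeff (β : ℝ) {u : ℂ} (hu : ‖u‖ < 1) :
    HasSum (fun n => binomLogCoeff β n * u ^ n) ((1 + u) ^ (β : ℂ) * Complex.log (1 + u)) := by
  have h1 := hasSum_binomCoeff β hu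
  have h2 := hasSum_logCoeff hu
  have h3 := (summable_norm_sum_mul_antidiagonal_of_summable_norm h1.summable.norm
    h2.summable.norm).of_norm.hasSum
  rw [← tsum_mul_tsum_eq_tsum_sum_antidiagonal_of_summable_norm h1.summable.norm
    h2.summable.norm, h1.tsum_eq, h2.tsum_eq] at h3
  convert! h3 using 2 with n
  rw [binomLogCoeff, Finset.sum_mul]
  refine Finset.sum_congr rfl fun p hp => ?_
  rw [← Finset.HasAntidiagonal.mem_antidiagonal.1 hp, pow_add]
  ring

lemma eventually_exp_mul_log_shift (c : ℂ) (φ β : ℝ) : ∀ᶠ r : ℝ in atTop,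
    Complex.exp (β * (Real.log r + φ * Complex.I +
      Complex.log (1 + -(c * Complex.exp (-(φ * Complex.I))) / r))) =
    Complex.exp (β * (φ * Complex.I)) * ((r ^ β : ℝ) : ℂ) *
      (1 + -(c * Complex.exp (-(φ * Complex.I))) / r) ^ (β : ℂ) := by
  have h1 := ((tendsto_const_div_atTop (-(c * Complex.exp (-(φ * Complex.I))))).const_add 1)
  rw [add_zero] at h1
  filter_upwards [h1.eventually_ne one_ne_zero, eventually_gt_atTop 0] with r hr hr0
  rw [Complex.cpow_def_of_ne_zero hr, mul_add, mul_add, Complex.exp_add, Complex.exp_add,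
    Complex.ofReal_cpow hr0.le, Complex.cpow_def_of_ne_zero (by exact_mod_cast hr0.ne'),
    Complex.ofReal_log hr0.le]
  ring_nf

/-- Expansion of `(z - c) ^ β` and `(z - c) ^ β * log (z - c)` along a ray. -/
lemma hasTailMod_shift {α β : ℝ} (hα : 0 ≤ α) (hβ : β ≤ α) (c : ℂ) (φ : ℝ) {lg : ℝ → ℂ}
    (hlg : ∀ᶠ r : ℝ in atTop, lg r = Real.log r + φ * Complex.I +
      Complex.log (1 + -(c * Complex.exp (-(φ * Complex.I))) / r)) :
    HasTailMod α (fun r => Complex.exp (β * lg r)) (constCoeff c β (binomCoeff β)) 0 ∧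
    HasTailMod α (fun r => Complex.exp (β * lg r) * lg r)
      (φ * Complex.I * constCoeff c β (binomCoeff β) + constCoeff c β (binomLogCoeff β))
      (constCoeff c β (binomCoeff β)) := by
  obtain ⟨h1, h2⟩ := hasTailMod_rpow_mul_series hα hβ c φ (fun u hu => hasSum_binomCoeff β hu)
  obtain ⟨h3, -⟩ := hasTailMod_rpow_mul_series hα hβ c φ (fun u hu => hasSum_binomLogCoeff β hu)
  constructor
  · refine h1.congr ?_
    filter_upwards [hlg, eventually_exp_mul_log_shift c φ β] with r h4 h5
    rw [h4, h5]
  · have h6 := ((h1.const_mul (φ * Complex.I)).add h3).add h2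
    simp only [mul_zero, zero_add, add_zero] at h6
    refine h6.congr ?_
    filter_upwards [hlg, eventually_exp_mul_log_shift c φ β] with r h4 h5
    rw [h4, h5]
    ring

/-- Since `α = j'/m`, the exponent `α - j/m` is a natural number `n` exactly when `j' = j + m n`;
this reindexes the sum over `j` by `n ≤ j'/m`. In that range the subtraction `j' - m * n` is not
truncated, and the conditional encodes `j ≤ N`. -/
lemma sum_mul_constCoeff {α : ℝ} {m N j' : ℕ} (hm : 0 < m) (hj' : α - (j' : ℝ) / m = 0) (c : ℂ)
    (D : ℕ → ℂ) (x : ℝ → ℕ → ℂ) :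
    ∑ j ∈ Finset.range (N + 1), D j * constCoeff c (α - (j : ℝ) / m) (x (α - (j : ℝ) / m)) =
      ∑ n ∈ Finset.range (j' / m + 1), (if j' - m * n ≤ N then D (j' - m * n) else 0) *
        ((-c) ^ n * x (α - ((j' - m * n : ℕ) : ℝ) / m) n) := by
  have hm' : (0 : ℝ) < m := by exact_mod_cast hm
  have hα : α = (j' : ℝ) / m := by linarith
  have h1 : ∀ j ∈ Finset.range (N + 1),
      D j * constCoeff c (α - (j : ℝ) / m) (x (α - (j : ℝ) / m)) =
      ∑ n ∈ Finset.range (j' / m + 1), if j = j' - m * n then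
        D j * ((-c) ^ n * x (α - (j : ℝ) / m) n) else 0 := by
    intro j _
    by_cases hb : ((⌊α - (j : ℝ) / m⌋₊ : ℕ) : ℝ) = α - (j : ℝ) / m
    · rw [constCoeff, if_pos hb]
      set n := ⌊α - (j : ℝ) / m⌋₊ with hn
      have hjn : j' = j + m * n := by
        have : (j' : ℝ) = j + m * n := by
          rw [hb, hα]; field_simp; ring
        exact_mod_cast this
      have hle : n ≤ j' / m := by
        rw [Nat.le_div_iff_mul_le hm, hjn, mul_comm]
        exact Nat.le_add_left _ _
      rw [Finset.sum_eq_single n]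
      · rw [if_pos (by omega)]
      · intro k hk hkn
        rw [if_neg]
        intro hjk
        apply hkn
        have hk' : k * m ≤ j' := (Nat.le_div_iff_mul_le hm).1
          (Nat.lt_succ_iff.1 (Finset.mem_range.1 hk))
        have : m * k = m * n := by rw [mul_comm k m] at hk'; omega
        exact Nat.eq_of_mul_eq_mul_left hm this
      · intro h
        simp only [Finset.mem_range] at h
        omega
    · rw [constCoeff, if_neg hb, mul_zero]
      refine (Finset.sum_eq_zero fun n hn => ?_).symm
      rw [if_neg]
      intro hjn
      apply hb
      have hn' : n * m ≤ j' := (Nat.le_div_iff_mul_le hm).1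
        (Nat.lt_succ_iff.1 (Finset.mem_range.1 hn))
      have h2 : j' = j + m * n := by rw [mul_comm n m] at hn'; omega
      have h3 : α - (j : ℝ) / m = n := by
        rw [hα, h2]; push_cast; field_simp; ring
      rw [h3, Nat.floor_natCast]
  rw [Finset.sum_congr rfl h1, Finset.sum_comm]
  refine Finset.sum_congr rfl fun n _ => ?_
  rw [Finset.sum_ite_eq' (Finset.range (N + 1)) (j' - m * n)]
  simp only [Finset.mem_range, Nat.lt_succ_iff, ite_mul, zero_mul]

lemma mu_self (c : ℂ) (β : ℝ) (n k : ℕ) : mu c β n k k = (-c) ^ n * binomCoeff β n := by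
  rw [mu, Finset.sum_eq_single 0]
  · simp [binomCoeff, stirlingSigned]
  · intro i _ hi
    obtain ⟨i, rfl⟩ := Nat.exists_eq_succ_of_ne_zero hi
    simp [stirlingSigned, Nat.stirlingFirst_succ_zero]
  · intro h
    simp at h

/-- Since `s(i+1, 1) = (-1)^i i!`, the factor `s(i+1, 1) / (i+1)!` is the coefficient of `u^{i+1}`
in `log (1 + u)`, and the sum is a Cauchy product. The index is `n + 1` because the logarithm has no
constant term. -/
lemma mu_zero_one (c : ℂ) (β : ℝ) (n : ℕ) :
    mu c β n 0 1 = (-c) ^ (n + 1) * binomLogCoeff β (n + 1) := by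
  have h1 : binomLogCoeff β (n + 1) =
      ∑ i ∈ Finset.range (n + 1), binomCoeff β (n - i) * logCoeff (i + 1) := by
    rw [binomLogCoeff, Finset.Nat.antidiagonal_succ', Finset.sum_cons]
    rw [← Finset.Nat.sum_antidiagonal_eq_sum_range_succ
      (fun i k => binomCoeff β k * logCoeff (i + 1)) n, ← Finset.Nat.sum_antidiagonal_swap,
      Finset.sum_map]
    simp [logCoeff]
  rw [mu, h1, Nat.sub_zero, add_comm 1 n]
  congr 1
  refine Finset.sum_congr rfl fun i _ => ?_
  have h2 : stirlingSigned (1 + i) 1 = (-1) ^ i * (i.factorial : ℤ) := by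
    rw [stirlingSigned, add_comm 1 i, Nat.stirlingFirst_one_right, pow_add, pow_add]
    ring
  rw [add_comm 1 i] at h2 ⊢
  rw [h2, binomCoeff, logCoeff, Nat.factorial_succ i, Nat.factorial_one]
  have h3 : (i.factorial : ℂ) ≠ 0 := by exact_mod_cast i.factorial_ne_zero
  have h4 : (i : ℂ) + 1 ≠ 0 := by exact_mod_cast i.succ_ne_zero
  push_cast
  rw [pow_add, pow_add]
  field_simp

lemma Omega_one {α : ℝ} {m N j' : ℕ} (hm : 0 < m) (hj' : α - (j' : ℝ) / m = 0) (c : ℂ)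
    (d : ℕ → ℕ → ℂ) : Omega c α m 1 N d j' 1 = ∑ j ∈ Finset.range (N + 1),
      d j 1 * constCoeff c (α - (j : ℝ) / m) (binomCoeff (α - (j : ℝ) / m)) := by
  rw [sum_mul_constCoeff hm hj' c (fun j => d j 1) binomCoeff, Omega]
  simp [mu_self]

/-- The terms `l = 0` of `Omega` come from `(z - c) ^ β`, the terms `l = 1` from the `log (1 + u)`
in `log (z - c)`. As `binomLogCoeff β 0 = 0`, the latter may be summed with a shifted index, and
they are absent when `j' / m = 0`. -/
lemma Omega_zero {α : ℝ} {m N j' : ℕ} (hm : 0 < m) (hj' : α - (j' : ℝ) / m = 0) (c : ℂ)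
    (d : ℕ → ℕ → ℂ) : Omega c α m 1 N d j' 0 =
      (∑ j ∈ Finset.range (N + 1),
        d j 0 * constCoeff c (α - (j : ℝ) / m) (binomCoeff (α - (j : ℝ) / m))) +
      ∑ j ∈ Finset.range (N + 1),
        d j 1 * constCoeff c (α - (j : ℝ) / m) (binomLogCoeff (α - (j : ℝ) / m)) := by
  rw [sum_mul_constCoeff hm hj' c (fun j => d j 0) binomCoeff,
    sum_mul_constCoeff hm hj' c (fun j => d j 1) binomLogCoeff, Omega]
  have h0 : ∀ β, binomLogCoeff β 0 = 0 := by
    intro β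
    simp [binomLogCoeff, logCoeff]
  rcases Nat.eq_zero_or_pos (j' / m) with h | h
  · simp [h, mu_self, h0]
  · rw [Nat.sub_zero, min_eq_right (by omega), Finset.sum_range_succ, Finset.sum_range_one]
    congr 1
    · simp [mu_self]
    · rw [Finset.sum_range_succ' _ (j' / m), show j' / m - 1 + 1 = j' / m by omega]
      simp only [h0, mul_zero, add_zero]
      refine Finset.sum_congr rfl fun n _ => ?_
      simp [mu_zero_one, add_comm 1 n]

/-- If `α - j/m` were a natural number `n`, then `α - (j + m n)/m` would vanish. -/
lemma constCoeff_eq_zero {α : ℝ} {m : ℕ} (hm : 0 < m) (h : ∀ j : ℕ, α - (j : ℝ) / m ≠ 0) (c : ℂ)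
    (j : ℕ) (x : ℕ → ℂ) : constCoeff c (α - (j : ℝ) / m) x = 0 := by
  rw [constCoeff, if_neg]
  intro hb
  refine h (j + m * ⌊α - (j : ℝ) / m⌋₊) ?_
  have hm' : (m : ℝ) ≠ 0 := by exact_mod_cast hm.ne'
  push_cast
  rw [hb]
  field_simp
  ring

/-- As `r → ∞` the term `log (1 + u)` tends to `0`, so the right side, a logarithm of `r e^{iφ} -
c`, has imaginary part within `π` of `Ψ`. This identifies the branch. -/
lemma logBranch_shift {Ψ φ : ℝ} (hφ : |φ - Ψ| < Real.pi) (c : ℂ) : ∀ᶠ r : ℝ in atTop,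
    logBranch Ψ (r * Complex.exp (φ * Complex.I) - c) = Real.log r + φ * Complex.I +
      Complex.log (1 + -(c * Complex.exp (-(φ * Complex.I))) / r) := by
  have h1 := ((tendsto_const_div_atTop (-(c * Complex.exp (-(φ * Complex.I))))).const_add 1)
  rw [add_zero] at h1
  have h2 : Tendsto (fun r : ℝ => (Complex.log (1 + -(c * Complex.exp (-(φ * Complex.I))) / r)).im)
      atTop (𝓝 0) := by
    have := (Complex.continuous_im.continuousAt.comp
      (continuousAt_clog (Complex.one_mem_slitPlane))).tendsto.comp h1
    simpa only [Complex.log_one, Complex.zero_im, Function.comp_def] using this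
  have hgap : 0 < Real.pi - |φ - Ψ| := by linarith
  filter_upwards [h1.eventually_ne one_ne_zero, eventually_gt_atTop 0,
    h2.eventually (Metric.ball_mem_nhds 0 hgap)] with r hr hr0 him
  rw [Real.dist_eq, sub_zero, abs_lt] at him
  have habs := abs_lt.1 (lt_of_le_of_lt (le_refl |φ - Ψ|) hφ)
  have hle := le_abs_self (φ - Ψ)
  have hge := neg_abs_le (φ - Ψ)
  have hrc : (r : ℂ) ≠ 0 := by exact_mod_cast hr0.ne'
  set X : ℂ := Real.log r + (φ - Ψ : ℝ) * Complex.I +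
      Complex.log (1 + -(c * Complex.exp (-(φ * Complex.I))) / r) with hX
  have hXim : X.im = (φ - Ψ) +
      (Complex.log (1 + -(c * Complex.exp (-(φ * Complex.I))) / r)).im := by
    simp only [hX, Complex.add_im, Complex.ofReal_im, Complex.mul_im, Complex.I_im, Complex.I_re,
      Complex.ofReal_re]
    ring
  have hexpX : Complex.exp X =
      (r * Complex.exp (φ * Complex.I) - c) * Complex.exp (-((Ψ : ℂ) * Complex.I)) := by
    rw [hX, Complex.exp_add, Complex.exp_add, Complex.exp_log hr, ← Complex.ofReal_exp,
      Real.exp_log hr0]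
    have e1 : Complex.exp (((φ - Ψ : ℝ) : ℂ) * Complex.I) =
        Complex.exp (φ * Complex.I) * Complex.exp (-((Ψ : ℂ) * Complex.I)) := by
      rw [← Complex.exp_add]
      congr 1
      push_cast
      ring
    rw [e1, Complex.exp_neg (φ * Complex.I)]
    have := Complex.exp_ne_zero (φ * Complex.I)
    field_simp
    ring
  rw [logBranch, ← hexpX, Complex.log_exp (by rw [hXim]; linarith) (by rw [hXim]; linarith), hX]
  push_cast
  ring

/-- Transfer of the expansion of `L z` to `L (z - c)` along a ray. -/
lemma HasExpansion.hasTailMod {L : ℂ → ℂ} {α Ψ ε δ : ℝ} {m N : ℕ} {d : ℕ → ℕ → ℂ} (hα : 0 ≤ α)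
    (hexp : HasExpansion L α Ψ ε m 1 N δ d) {φ : ℝ} (hφ : |φ - Ψ| < Real.pi) {c : ℂ}
    (ht : Tendsto (fun r : ℝ => (r : ℂ) * Complex.exp (φ * Complex.I) - c) atTop
      (sectorAtInfty Ψ ε)) :
    ∃ κ₀ κ₁ : ℂ, HasTailMod α (fun r => L (r * Complex.exp (φ * Complex.I) - c)) κ₀ κ₁ ∧
      ((∀ j : ℕ, α - (j : ℝ) / m ≠ 0) → κ₀ = 0 ∧ κ₁ = 0) ∧
      ∀ j : ℕ, α - (j : ℝ) / m = 0 → κ₁ = Omega c α m 1 N d j 1 ∧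
        κ₀ = Omega c α m 1 N d j 0 + φ * Complex.I * Omega c α m 1 N d j 1 := by
  have hm' : (0 : ℝ) < m := by exact_mod_cast hexp.m_pos
  have hlg := logBranch_shift hφ c
  set lg : ℝ → ℂ := fun r => logBranch Ψ (r * Complex.exp (φ * Complex.I) - c) with hlgdef
  have hterm := HasTailMod.sum hα (Finset.range (N + 1)) fun j _ => by
    have hβ : α - (j : ℝ) / m ≤ α := by
      have : 0 ≤ (j : ℝ) / m := by positivity
      linarith
    exact (((hasTailMod_shift hα hβ c φ hlg).1.const_mul (d j 0)).add
      ((hasTailMod_shift hα hβ c φ hlg).2.const_mul (d j 1)))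
  -- The condition `N / m > α - δ` is exactly what makes the error term decay.
  have hη : 0 < (N : ℝ) / m + δ - α := by linarith [hexp.lt_exponent]
  have hrem := (hexp.isLittleO.comp_tendsto ht).isBigO
  have hnorm : (fun r : ℝ => ‖(r : ℂ) * Complex.exp (φ * Complex.I) - c‖ ^
      (α - (N : ℝ) / m - δ)) =O[atTop] fun r : ℝ => r ^ (-((N : ℝ) / m + δ - α)) := by
    refine IsBigO.of_bound ((1 / 2 : ℝ) ^ (α - (N : ℝ) / m - δ)) ?_
    filter_upwards [eventually_gt_atTop 0, eventually_ge_atTop (2 * ‖c‖)] with r hr hrc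
    rw [Real.norm_of_nonneg (by positivity), Real.norm_of_nonneg (by positivity),
      show -((N : ℝ) / m + δ - α) = α - (N : ℝ) / m - δ by ring,
      ← Real.mul_rpow (by norm_num) hr.le]
    -- The exponent is negative, so the lower bound `‖z - c‖ ≥ r / 2` is the one needed.
    refine Real.rpow_le_rpow_of_nonpos (by positivity) ?_ (by linarith)
    have h1 := norm_sub_norm_le ((r : ℂ) * Complex.exp (φ * Complex.I)) c
    rw [norm_mul, Complex.norm_exp_ofReal_mul_I, mul_one, Complex.norm_real,
      Real.norm_of_nonneg hr.le] at h1
    linarith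
  have hall := hterm.add (hasTailMod_of_isBigO hα hη (hrem.trans hnorm))
  refine ⟨_, _, hall.congr (Eventually.of_forall fun r => ?_), fun h => ?_, fun j hj => ?_⟩
  · simp only [Function.comp_apply, Finset.sum_range_succ, Finset.sum_range_zero, zero_add,
      pow_zero, mul_one, pow_one]
    have : ∀ X Y : ℂ, X = Y → X + (L (r * Complex.exp (φ * Complex.I) - c) - Y) =
      L (r * Complex.exp (φ * Complex.I) - c) := fun X Y h => by rw [h]; ring
    apply this
    congr 1
    · exact Finset.sum_congr rfl fun j _ => by ring
    · ring
  · simp [constCoeff_eq_zero hexp.m_pos h]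
  · rw [Omega_one hexp.m_pos hj, Omega_zero hexp.m_pos hj]
    simp only [mul_zero, zero_add, add_zero, Finset.sum_add_distrib, mul_add, true_and]
    rw [Finset.mul_sum]
    have : ∀ x y z w : ℂ, z = w → x + (z + y) = x + y + w := fun x y z w h => by rw [h]; ring
    apply this
    exact Finset.sum_congr rfl fun j _ => by ring

/-! ### The zeta function as a Mellin transform of the logarithm -/

/-- Mean value inequality on `[t, r]`, then `t → 0`; only the limit of `g` at `0` is known, not its
value there. -/
lemma norm_le_mul_rpow_of_deriv_le {g D : ℝ → ℂ} (hg : ∀ r : ℝ, 0 < r → HasDerivAt g (D r) r)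
    (hg0 : Tendsto g (𝓝[>] 0) (𝓝 0)) {C : ℝ} {q : ℕ} (hD : ∀ r : ℝ, 0 < r → ‖D r‖ ≤ C * r ^ q)
    {r : ℝ} (hr : 0 < r) : ‖g r‖ ≤ C * r ^ (q + 1) := by
  have hC : 0 ≤ C := by
    have := (norm_nonneg _).trans (hD 1 one_pos)
    simpa using this
  have h1 : ∀ t ∈ Set.Ioo 0 r, ‖g r - g t‖ ≤ C * r ^ (q + 1) := by
    intro t ht
    have h2 := (convex_Icc t r).norm_image_sub_le_of_norm_hasDerivWithin_le (f := g) (f' := D)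
      (C := C * r ^ q) (fun x hx => (hg x (ht.1.trans_le hx.1)).hasDerivWithinAt)
      (fun x hx => (hD x (ht.1.trans_le hx.1)).trans (by
        have : 0 ≤ x := ht.1.le.trans hx.1
        gcongr
        exact hx.2)) (Set.left_mem_Icc.2 ht.2.le) (Set.right_mem_Icc.2 ht.2.le)
    refine h2.trans ?_
    rw [Real.norm_of_nonneg (by linarith [ht.2]), pow_succ, ← mul_assoc]
    have : 0 ≤ C * r ^ q := by positivity
    nlinarith [ht.1]
  have h3 : Tendsto (fun t => ‖g r - g t‖) (𝓝[>] 0) (𝓝 ‖g r - 0‖) :=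
    (hg0.const_sub (g r)).norm
  rw [sub_zero] at h3
  refine le_of_tendsto h3 ?_
  filter_upwards [Ioo_mem_nhdsGT hr] with t ht using h1 t ht

/-- The Mellin representation of the zeta function of `w` and its continuation, in terms of a
logarithm `f` on the positive axis of an entire function `H` with zeros `-w n`. -/
theorem exists_hasSum_cpow_neg {w : ℕ → ℂ} (hw : ∀ n, w n ∈ Complex.slitPlane) {c : ℝ} (hc : 0 < c)
    (hcw : ∀ n, ∀ r : ℝ, 0 ≤ r → c * (r + ‖w n‖) ≤ ‖(r : ℂ) + w n‖)
    (hwt : Tendsto (fun n => ‖w n‖) atTop atTop) {α : ℝ} (hα : 0 ≤ α)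
    (hsum : ∀ σ : ℝ, α < σ → Summable fun n => ‖w n‖ ^ (-σ)) {H : ℂ → ℂ} (hH : Differentiable ℂ H)
    (hzer : ∀ z, analyticOrderAt H z = Set.encard {n | -w n = z})
    (hgrow : ∀ ρ : ℝ, α < ρ → ∃ K : ℝ, ∀ᶠ R : ℝ in atTop, ∀ z, ‖z‖ = R →
      ‖H z‖ ≤ K * Real.exp (K * R ^ ρ))
    {f : ℝ → ℂ} (hf : ∀ r : ℝ, 0 < r → HasDerivAt f (logDeriv H r) r) {f₀ : ℂ}
    (hf0 : Tendsto f (𝓝[>] 0) (𝓝 f₀)) {κ₀ κ₁ : ℂ} (htail : HasTailMod α f κ₀ κ₁) :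
    ∃ η b : ℝ, 0 < η ∧ α < b ∧ ∃ P : ℂ → ℂ, MeromorphicOn P {s : ℂ | -η < s.re ∧ s.re < b} ∧
      AnalyticAt ℂ P 0 ∧ ∀ s : ℂ, α < s.re → s.re < b → HasSum (fun n => w n ^ (-s))
        (s * Complex.sin (Real.pi * s) / Real.pi * (P s + (κ₀ - f₀) / s + κ₁ / s ^ 2)) := by
  set q : ℕ := ⌊α⌋₊ with hqdef
  have hqα : (q : ℝ) ≤ α := Nat.floor_le hα
  have hαq : α < q + 1 := Nat.lt_floor_add_one α
  have hw0 : ∀ n, w n ≠ 0 := fun n => Complex.slitPlane_ne_zero (hw n)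
  have hwpos : ∀ n, 0 < ‖w n‖ := fun n => norm_pos_iff.2 (hw0 n)
  have hne : ∀ r : ℝ, 0 ≤ r → ∀ n, (r : ℂ) ≠ -w n := by
    intro r hr n h
    have h1 := hcw n r hr
    rw [h, neg_add_cancel, norm_zero] at h1
    have := hwpos n
    have : 0 < c * (r + ‖w n‖) := by positivity
    linarith
  have hHr : ∀ r : ℝ, 0 ≤ r → H r ≠ 0 := by
    intro r hr
    refine ((hH.analyticAt r).analyticOrderAt_eq_zero).1 ?_
    rw [hzer, Set.encard_eq_zero]
    ext n
    simpa using (hne r hr n).symm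
  have hsumq : Summable fun n => (‖w n‖ ^ (q + 1))⁻¹ := by
    refine (hsum (q + 1) hαq).congr fun n => ?_
    rw [Real.rpow_neg (norm_nonneg _), show ((q : ℝ) + 1) = ((q + 1 : ℕ) : ℝ) by push_cast; ring,
      Real.rpow_natCast]
  obtain ⟨ρ, hρ1, hρ2⟩ := exists_between hαq
  obtain ⟨K, hK⟩ := hgrow ρ hρ1
  set D : ℝ → ℂ := fun r => taylorRem q (logDeriv H) r with hDdef
  have hD : ∀ r : ℝ, 0 < r → HasSum (fun n => (-r / w n) ^ q / (r + w n)) (D r) := by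
    intro r hr
    have := hasSum_taylorRem_logDeriv hH hzer (fun n => neg_ne_zero.2 (hw0 n))
      (by simpa using hwt) (hα.trans hρ1.le) hρ2 hK (by simpa using hsumq) (hne r hr.le)
    simpa only [div_neg, sub_neg_eq_add, ← neg_div] using this
  set ℓ : ℕ → ℂ := fun i => ((i.factorial : ℂ))⁻¹ * iteratedDeriv i (logDeriv H) 0 with hℓ
  -- The logarithm minus its limit and minus the primitive of the Taylor polynomial of `H'/H`, so
  -- that `g' = D`. Real powers are used so that `hasTail_rpow` applies to each term.
  set g : ℝ → ℂ := fun r => f r + (-f₀) * ((r ^ (0 : ℝ) : ℝ) : ℂ) +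
    ∑ i ∈ Finset.range q, -(ℓ i / (i + 1)) * ((r ^ ((i : ℝ) + 1) : ℝ) : ℂ) with hgdef
  have hgpow : ∀ r : ℝ, g r = f r - f₀ - ∑ i ∈ Finset.range q, ℓ i / (i + 1) * (r : ℂ) ^ (i + 1) := by
    intro r
    simp only [hgdef, Real.rpow_zero, Complex.ofReal_one, mul_one, neg_mul,
      Finset.sum_neg_distrib]
    have : ∀ i : ℕ, ((r ^ ((i : ℝ) + 1) : ℝ) : ℂ) = (r : ℂ) ^ (i + 1) := by
      intro i
      rw [show ((i : ℝ) + 1) = ((i + 1 : ℕ) : ℝ) by push_cast; ring, Real.rpow_natCast]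
      push_cast
      rfl
    simp only [this]
    ring
  have hg : ∀ r : ℝ, 0 < r → HasDerivAt g (D r) r := by
    intro r hr
    have h1 : HasDerivAt (fun r : ℝ => ∑ i ∈ Finset.range q, ℓ i / (i + 1) * (r : ℂ) ^ (i + 1))
        (∑ i ∈ Finset.range q, ℓ i * (r : ℂ) ^ i) r := by
      refine HasDerivAt.fun_sum fun i _ => ?_
      have h2 := ((hasDerivAt_pow (i + 1) (r : ℂ)).comp_ofReal).const_mul (ℓ i / (i + 1))
      have h3 : (i : ℂ) + 1 ≠ 0 := by exact_mod_cast i.succ_ne_zero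
      convert! h2 using 1
      push_cast
      field_simp
    have h4 := ((hf r hr).sub_const f₀).sub h1
    have h5 : g = fun r : ℝ => f r - f₀ - ∑ i ∈ Finset.range q, ℓ i / (i + 1) * (r : ℂ) ^ (i + 1) :=
      funext hgpow
    rw [h5]
    exact h4
  have hgc : ContinuousOn g (Set.Ioi 0) := fun r hr => (hg r hr).continuousAt.continuousWithinAt
  have hDc : ContinuousOn D (Set.Ioi 0) := by
    intro r hr
    have hr0 : (0 : ℝ) < r := hr
    have h1 : ContinuousAt (taylorRem q (logDeriv H)) (r : ℂ) := by
      unfold taylorRem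
      have h2 : ContinuousAt (logDeriv H) (r : ℂ) :=
        ((hH.analyticAt r).deriv.div (hH.analyticAt r) (hHr r hr0.le)).continuousAt
      exact h2.sub (by fun_prop)
    exact (h1.comp Complex.continuous_ofReal.continuousAt).continuousWithinAt
  -- Read off from Hadamard's series with `‖r + w n‖ ≥ c ‖w n‖`; integrated, it gives the order `q +
  -- 1` of vanishing of `g` at `0`.
  have hDb : ∀ r : ℝ, 0 < r → ‖D r‖ ≤ (c⁻¹ * ∑' n, (‖w n‖ ^ (q + 1))⁻¹) * r ^ q := by
    intro r hr
    have h1 : HasSum (fun n => c⁻¹ * (‖w n‖ ^ (q + 1))⁻¹ * r ^ q)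
        ((c⁻¹ * ∑' n, (‖w n‖ ^ (q + 1))⁻¹) * r ^ q) :=
      (hsumq.hasSum.mul_left c⁻¹).mul_right _
    refine (hD r hr).norm_le_of_bounded h1 fun n => ?_
    have hn := hwpos n
    rw [norm_div, norm_pow, norm_div, norm_neg, Complex.norm_real, Real.norm_of_nonneg hr.le]
    calc (r / ‖w n‖) ^ q / ‖(r : ℂ) + w n‖ ≤ (r / ‖w n‖) ^ q / (c * ‖w n‖) := by
          gcongr
          refine le_trans ?_ (hcw n r hr.le)
          gcongr
          linarith
      _ = _ := by rw [div_pow, pow_succ]; field_simp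
  have hg0 : Tendsto g (𝓝[>] 0) (𝓝 0) := by
    have h1 : Tendsto (fun r : ℝ => ∑ i ∈ Finset.range q, ℓ i / (i + 1) * (r : ℂ) ^ (i + 1))
        (𝓝[>] 0) (𝓝 0) := by
      have h2 : Continuous fun r : ℝ =>
          ∑ i ∈ Finset.range q, ℓ i / (i + 1) * (r : ℂ) ^ (i + 1) := by fun_prop
      have h3 := h2.tendsto 0
      simp only [Complex.ofReal_zero, ne_eq, Nat.add_eq_zero_iff, one_ne_zero, and_false,
        not_false_eq_true, zero_pow, mul_zero, Finset.sum_const_zero] at h3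
      exact h3.mono_left nhdsWithin_le_nhds
    have h4 := (hf0.sub_const f₀).sub h1
    rw [sub_self, sub_zero] at h4
    exact h4.congr fun r => (hgpow r).symm
  have hgO : g =O[𝓝[>] 0] fun r : ℝ => r ^ ((q : ℝ) + 1) := by
    refine IsBigO.of_bound (c⁻¹ * ∑' n, (‖w n‖ ^ (q + 1))⁻¹) ?_
    filter_upwards [self_mem_nhdsWithin] with r hr
    have hr0 : (0 : ℝ) < r := hr
    rw [Real.norm_of_nonneg (by positivity),
      show ((q : ℝ) + 1) = ((q + 1 : ℕ) : ℝ) by push_cast; ring, Real.rpow_natCast]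
    exact norm_le_mul_rpow_of_deriv_le hg hg0 hDb hr0
  -- The subtracted powers have exponents `1, …, q`, none zero and none above `α`, so only the
  -- constant `f₀` alters the principal part at `0`.
  have hgtail : HasTail α g (κ₀ - f₀) κ₁ := by
    refine HasTailMod.hasTail hα ?_ hgc
    have h1 := HasTailMod.sum hα (Finset.range q) fun i hi =>
      ((hasTail_rpow (α := α) (β := (i : ℝ) + 1) (by
        have : (i : ℝ) + 1 ≤ q := by exact_mod_cast Finset.mem_range.1 hi
        linarith)).const_mul (-(ℓ i / (i + 1)))).hasTailMod
    have h2 := (htail.add ((hasTail_rpow hα).const_mul (-f₀)).hasTailMod).add h1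
    have h3 : ∀ i : ℕ, ((i : ℝ) + 1 = 0) = False := fun i =>
      eq_false (by positivity)
    simpa only [h3, if_true, if_false, mul_one, mul_zero, Finset.sum_const_zero, add_zero,
      ← sub_eq_add_neg] using h2
  obtain ⟨η, hη, P, hP, hP0, hPs⟩ := hgtail.exists_mellin_eq (by positivity) hgO
  refine ⟨η, q + 1, hη, hαq, P, hP, hP0, fun s hs hsq => ?_⟩
  obtain ⟨b, hb1, hb2⟩ := exists_between hs
  rw [← hPs s hs hsq]
  exact hasSum_cpow_neg hw hc hcw (hqα.trans_lt hs) hsq (hsum _ hs) hg hD hDc hb2 hgO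
    (hgtail.isBigO b hb1)

/-! ### Gluing the continuation and differentiating at `0` -/

lemma norm_cpow_neg_le {w s : ℂ} (hw : w ≠ 0) :
    ‖w ^ (-s)‖ ≤ Real.exp (Real.pi * |s.im|) * ‖w‖ ^ (-s.re) := by
  rw [Complex.norm_cpow_of_ne_zero hw, Complex.neg_re, Complex.neg_im, div_eq_mul_inv,
    ← Real.exp_neg, mul_comm]
  gcongr
  have h1 := Complex.abs_arg_le_pi w
  calc -(w.arg * -s.im) ≤ |-(w.arg * -s.im)| := le_abs_self _
    _ = |w.arg| * |s.im| := by rw [abs_neg, abs_mul, abs_neg]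
    _ ≤ _ := by gcongr

lemma summable_cpow_neg {w : ℕ → ℂ} (hw : ∀ n, w n ≠ 0) {s : ℂ}
    (hsum : Summable fun n => ‖w n‖ ^ (-s.re)) : Summable fun n => w n ^ (-s) :=
  Summable.of_norm_bounded (hsum.mul_left _) fun n => norm_cpow_neg_le (hw n)

lemma analyticAt_tsum_cpow_neg {w : ℕ → ℂ} (hw : ∀ n, w n ≠ 0) {α : ℝ}
    (hsum : ∀ σ : ℝ, α < σ → Summable fun n => ‖w n‖ ^ (-σ)) {s : ℂ} (hs : α < s.re) :
    AnalyticAt ℂ (fun s => ∑' n, w n ^ (-s)) s := by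
  obtain ⟨σ, hσ1, hσ2⟩ := exists_between hs
  set U : Set ℂ := {z | σ < z.re ∧ z.re < s.re + 1 ∧ |z.im| < |s.im| + 1} with hU
  have hUo : IsOpen U := by
    refine (isOpen_lt continuous_const Complex.continuous_re).inter
      ((isOpen_lt Complex.continuous_re continuous_const).inter
      (isOpen_lt (continuous_abs.comp Complex.continuous_im) continuous_const))
  have hsU : s ∈ U := ⟨hσ2, by linarith, by linarith⟩
  refine DifferentiableOn.analyticAt (s := U) ?_ (hUo.mem_nhds hsU)
  -- Both endpoints of the range of `Re z` enter the majorant, since `‖w n‖` may lie on either side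
  -- of `1`.
  refine Complex.differentiableOn_tsum_of_summable_norm (u := fun n =>
    Real.exp (Real.pi * (|s.im| + 1)) * (‖w n‖ ^ (-σ) + ‖w n‖ ^ (-(s.re + 1))))
    (((hsum σ hσ1).add (hsum (s.re + 1) (by linarith))).mul_left _) (fun n => ?_) hUo
    fun n z hz => ?_
  · intro z _
    exact ((differentiableAt_id.neg).const_cpow (Or.inl (hw n))).differentiableWithinAt
  · refine (norm_cpow_neg_le (hw n)).trans ?_
    have hn : 0 < ‖w n‖ := norm_pos_iff.2 (hw n)
    have h1 : ‖w n‖ ^ (-z.re) ≤ ‖w n‖ ^ (-σ) + ‖w n‖ ^ (-(s.re + 1)) := by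
      rcases le_total 1 ‖w n‖ with h | h
      · have := Real.rpow_le_rpow_of_exponent_le h (by linarith [hz.1] : -z.re ≤ -σ)
        have h2 : 0 ≤ ‖w n‖ ^ (-(s.re + 1)) := by positivity
        linarith
      · have := Real.rpow_le_rpow_of_exponent_ge hn h
          (by linarith [hz.2.1] : -(s.re + 1) ≤ -z.re)
        have h2 : 0 ≤ ‖w n‖ ^ (-σ) := by positivity
        linarith
    have h3 := hz.2.2.le
    gcongr

/-- The entire function `sin (π s) / (π s)`. -/
def sincPi (s : ℂ) : ℂ := dslope Complex.sin 0 (Real.pi * s)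

lemma sincPi_of_ne {s : ℂ} (hs : s ≠ 0) :
    sincPi s = Complex.sin (Real.pi * s) / (Real.pi * s) := by
  have : (Real.pi : ℂ) * s ≠ 0 := mul_ne_zero (by exact_mod_cast Real.pi_ne_zero) hs
  rw [sincPi, dslope_of_ne _ this, slope_def_field]
  simp

lemma sincPi_zero : sincPi 0 = 1 := by
  simp [sincPi, dslope_same]

lemma differentiable_sincPi : Differentiable ℂ sincPi := by
  intro z
  have h1 := (Complex.differentiableOn_dslope (f := Complex.sin) (c := 0) (s := Set.univ)
    Filter.univ_mem).2 Complex.differentiable_sin.differentiableOn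
  have h2 : DifferentiableAt ℂ (dslope Complex.sin 0) (Real.pi * z) :=
    (h1 _ trivial).differentiableAt Filter.univ_mem
  exact h2.comp z (by fun_prop)

/-- An even function has derivative `0` at the origin. -/
lemma hasDerivAt_sincPi_zero : HasDerivAt sincPi 0 0 := by
  have h1 := (differentiable_sincPi 0).hasDerivAt
  have h2 : HasDerivAt sincPi (-deriv sincPi 0) 0 := by
    have h3 : HasDerivAt (fun s => sincPi (-s)) (-deriv sincPi 0) 0 := by
      have h4 : HasDerivAt sincPi (deriv sincPi 0) (-0) := by rwa [neg_zero]
      have := h4.comp 0 (hasDerivAt_neg 0)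
      simpa [Function.comp_def] using this
    refine h3.congr_of_eventuallyEq (Eventually.of_forall fun s => ?_)
    rcases eq_or_ne s 0 with rfl | hs
    · simp
    · simp only
      rw [sincPi_of_ne hs, sincPi_of_ne (neg_ne_zero.2 hs), mul_neg, Complex.sin_neg,
        neg_div_neg_eq]
  have h5 : deriv sincPi 0 = 0 := by
    have := h1.unique h2
    linear_combination this / 2
  rwa [h5] at h1

/-- Construction of the continuation and its derivative at `0`. -/
theorem exists_continuation {w : ℕ → ℂ} (hw : ∀ n, w n ≠ 0) {α : ℝ} (hα : 0 ≤ α)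
    (hsum : ∀ σ : ℝ, α < σ → Summable fun n => ‖w n‖ ^ (-σ)) {η b : ℝ} (hη : 0 < η) (hb : α < b)
    {P : ℂ → ℂ} (hP : MeromorphicOn P {s : ℂ | -η < s.re ∧ s.re < b}) (hP0 : AnalyticAt ℂ P 0)
    {κ₀ κ₁ : ℂ} (hPs : ∀ s : ℂ, α < s.re → s.re < b → HasSum (fun n => w n ^ (-s))
        (s * Complex.sin (Real.pi * s) / Real.pi * (P s + κ₀ / s + κ₁ / s ^ 2))) (τ : ℂ) :
    ∃ Z : ℂ → ℂ, (∀ s : ℂ, α < s.re →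
        HasSum (fun n => Complex.exp (-s * τ) * w n ^ (-s)) (Z s)) ∧
      (∃ σ : ℝ, σ < 0 ∧ MeromorphicOn Z {s : ℂ | σ < s.re}) ∧ AnalyticAt ℂ Z 0 ∧
      deriv Z 0 = κ₀ - τ * κ₁ := by
  classical
  -- This uses `s sin(πs) / π = s ^ 2 * sincPi s`: the factor `s ^ 2` clears the double pole. `E`
  -- describes the function for `-η < Re s < b`, the series for `Re s > α`, and they agree on the
  -- overlap.
  set E : ℂ → ℂ := fun s =>
    Complex.exp (-s * τ) * (sincPi s * (s ^ 2 * P s + κ₁ + κ₀ * s)) with hE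
  set Z : ℂ → ℂ := fun s =>
    if α < s.re then Complex.exp (-s * τ) * ∑' n, w n ^ (-s) else E s with hZ
  have hZE : ∀ s : ℂ, s.re < b → Z s = E s := by
    intro s hsb
    simp only [hZ]
    split_ifs with h
    · have hs0 : s ≠ 0 := by
        rintro rfl
        simp only [Complex.zero_re] at h
        linarith
      have hpi : (Real.pi : ℂ) ≠ 0 := by exact_mod_cast Real.pi_ne_zero
      rw [(hPs s h hsb).tsum_eq, hE]
      simp only
      rw [sincPi_of_ne hs0]
      field_simp
      ring
    · rfl
  have hnear : ∀ s : ℂ, s.re < b → Z =ᶠ[𝓝 s] E := by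
    intro s hs
    filter_upwards [(isOpen_lt Complex.continuous_re continuous_const).mem_nhds hs] with z hz
    exact hZE z hz
  have hS : ∀ s, AnalyticAt ℂ sincPi s := fun s => differentiable_sincPi.analyticAt s
  refine ⟨Z, fun s hs => ?_, ⟨-η, by linarith, fun s hs => ?_⟩, ?_, ?_⟩
  · simp only [hZ, if_pos hs]
    exact (summable_cpow_neg hw (hsum _ hs)).hasSum.mul_left _
  · have hs : -η < s.re := hs
    rcases lt_or_ge α s.re with h | h
    · have h1 : AnalyticAt ℂ (fun s => Complex.exp (-s * τ) * ∑' n, w n ^ (-s)) s :=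
        AnalyticAt.mul (by fun_prop) (analyticAt_tsum_cpow_neg hw hsum h)
      refine (h1.congr ?_).meromorphicAt
      filter_upwards [(isOpen_lt continuous_const Complex.continuous_re).mem_nhds h] with z hz
      simp only [hZ]
      rw [if_pos hz]
    · have h2 : MeromorphicAt E s := by
        have h3 : MeromorphicAt P s := hP s ⟨hs, h.trans_lt hb⟩
        have h4 : AnalyticAt ℂ (fun s : ℂ => Complex.exp (-s * τ)) s := by fun_prop
        have h5 : AnalyticAt ℂ (fun s : ℂ => s ^ 2) s := by fun_prop
        have h6 : AnalyticAt ℂ (fun s : ℂ => κ₀ * s) s := by fun_prop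
        exact h4.meromorphicAt.mul ((hS s).meromorphicAt.mul
          (((h5.meromorphicAt.mul h3).add (MeromorphicAt.const κ₁ s)).add h6.meromorphicAt))
      exact h2.congr ((hnear s (h.trans_lt hb)).symm.filter_mono nhdsWithin_le_nhds)
  · have h1 : AnalyticAt ℂ E 0 := by
      have := hS 0
      simp only [hE]
      fun_prop
    exact h1.congr (hnear 0 (by simpa using hα.trans_lt hb)).symm
  · rw [(hnear 0 (by simpa using hα.trans_lt hb)).deriv_eq]
    have h1 : HasDerivAt (fun s : ℂ => Complex.exp (-s * τ)) (-τ) 0 := by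
      have := ((hasDerivAt_neg (0 : ℂ)).mul_const τ).cexp
      simpa using this
    have h2 : HasDerivAt (fun s : ℂ => s ^ 2 * P s + κ₁ + κ₀ * s) κ₀ 0 := by
      have := ((((hasDerivAt_pow 2 (0 : ℂ)).mul hP0.differentiableAt.hasDerivAt).add_const κ₁).add
        ((hasDerivAt_id (0 : ℂ)).const_mul κ₀))
      convert! this using 1
      simp
    have h3 := h1.mul (hasDerivAt_sincPi_zero.mul h2)
    have h4 : HasDerivAt E _ 0 := h3
    rw [h4.deriv]
    simp [sincPi_zero]
    ring

/-! ### Summability and position of the shifted sequence -/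

lemma IsAdmissible.exponent_nonneg {a : ℕ → ℂ} {α Ψ ε : ℝ} (ha : IsAdmissible a α Ψ ε) :
    0 ≤ α := by
  have h2 : (0 : EReal) ≤ limsup
      (fun n : ℕ => ((Real.log ((n : ℝ) + 1) / Real.log ‖a n‖ : ℝ) : EReal)) atTop := by
    refine le_limsup_of_frequently_le (Eventually.frequently ?_)
    filter_upwards [ha.tendsto.eventually_ge_atTop 1] with n hn
    have : 0 ≤ Real.log ((n : ℝ) + 1) / Real.log ‖a n‖ :=
      div_nonneg (Real.log_nonneg (by linarith [n.cast_nonneg (α := ℝ)])) (Real.log_nonneg hn)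
    exact_mod_cast this
  rw [ha.exponent] at h2
  exact_mod_cast h2

/-- For `α < β < σ` one has `n + 1 < ‖a n‖ ^ β` eventually, hence `‖a n‖ ^ (-σ) ≤ (n + 1) ^ (-σ/β)`
with `σ/β > 1`. -/
lemma IsAdmissible.summable_rpow {a : ℕ → ℂ} {α Ψ ε : ℝ} (ha : IsAdmissible a α Ψ ε) {σ : ℝ}
    (hσ : α < σ) : Summable fun n => ‖a n‖ ^ (-σ) := by
  have hα := ha.exponent_nonneg
  obtain ⟨β, hβ1, hβ2⟩ := exists_between hσ
  have hβ : 0 < β := hα.trans_lt hβ1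
  have h1 : ∀ᶠ n : ℕ in atTop,
      ((Real.log ((n : ℝ) + 1) / Real.log ‖a n‖ : ℝ) : EReal) < (β : EReal) :=
    eventually_lt_of_limsup_lt (by rw [ha.exponent]; exact_mod_cast hβ1)
  have hs : Summable fun n : ℕ => ((n : ℝ) + 1) ^ (-(σ / β)) := by
    have := (summable_nat_add_iff 1).2
      (Real.summable_nat_rpow.2 (show -(σ / β) < -1 by
        rw [neg_lt_neg_iff, lt_div_iff₀ hβ]; linarith))
    simpa using this
  refine Summable.of_norm_bounded_eventually_nat hs ?_
  filter_upwards [h1, ha.tendsto.eventually_gt_atTop 1] with n hn1 hn2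
  have hlog : 0 < Real.log ‖a n‖ := Real.log_pos hn2
  have hn3 : Real.log ((n : ℝ) + 1) / Real.log ‖a n‖ < β := by exact_mod_cast hn1
  rw [div_lt_iff₀ hlog] at hn3
  have hn0 : (0 : ℝ) < n + 1 := by positivity
  rw [Real.norm_of_nonneg (by positivity), Real.rpow_def_of_pos (by linarith),
    Real.rpow_def_of_pos hn0]
  apply Real.exp_le_exp.2
  have h4 : Real.log ((n : ℝ) + 1) * (σ / β) ≤ β * Real.log ‖a n‖ * (σ / β) :=
    mul_le_mul_of_nonneg_right hn3.le (div_nonneg (hα.trans hσ.le) hβ.le)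
  have h5 : β * Real.log ‖a n‖ * (σ / β) = Real.log ‖a n‖ * σ := by field_simp
  linarith

lemma tendsto_norm_add_const {a : ℕ → ℂ} (ha : Tendsto (fun n => ‖a n‖) atTop atTop) (c : ℂ) :
    Tendsto (fun n => ‖a n + c‖) atTop atTop := by
  refine tendsto_atTop_mono (fun n => ?_) (tendsto_atTop_add_const_right _ (-‖c‖) ha)
  have := norm_sub_le (a n + c) c
  rw [add_sub_cancel_right] at this
  linarith

lemma summable_rpow_add_const {a : ℕ → ℂ} (ha : Tendsto (fun n => ‖a n‖) atTop atTop) (c : ℂ)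
    {σ : ℝ} (hσ : 0 ≤ σ) (h : Summable fun n => ‖a n‖ ^ (-σ)) :
    Summable fun n => ‖a n + c‖ ^ (-σ) := by
  refine Summable.of_norm_bounded_eventually_nat (h.mul_left ((1 / 2 : ℝ) ^ (-σ))) ?_
  filter_upwards [ha.eventually_gt_atTop (2 * ‖c‖), ha.eventually_gt_atTop 0] with n hn hn0
  rw [Real.norm_of_nonneg (by positivity), ← Real.mul_rpow (by norm_num) hn0.le]
  have := norm_sub_le (a n + c) c
  rw [add_sub_cancel_right] at this
  exact Real.rpow_le_rpow_of_nonpos (by positivity) (by linarith) (by linarith)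

/-- Multiplication by `-e^{-iΨ}` carries the sector about `Ψ` to the one about the negative axis.
The two sides of that axis have principal arguments near `π` and `-π`, hence the two cases. -/
lemma abs_arg_le_of_notMem_sector {Ψ ε : ℝ} {b : ℂ} (hb : b ≠ 0) (h : b ∉ sector Ψ ε) :
    |(-b * Complex.exp (-((Ψ : ℂ) * Complex.I))).arg| ≤ Real.pi - ε := by
  set w := -b * Complex.exp (-((Ψ : ℂ) * Complex.I)) with hw
  have hw0 : w ≠ 0 := mul_ne_zero (neg_ne_zero.2 hb) (Complex.exp_ne_zero _)
  have hb1 : b = w * (-1) * Complex.exp ((Ψ : ℂ) * Complex.I) := by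
    rw [hw, show -b * Complex.exp (-((Ψ : ℂ) * Complex.I)) * (-1) *
      Complex.exp ((Ψ : ℂ) * Complex.I) = b * (Complex.exp (-((Ψ : ℂ) * Complex.I)) *
        Complex.exp ((Ψ : ℂ) * Complex.I)) by ring, ← Complex.exp_add]
    simp
  have hpol : w = (‖w‖ : ℂ) * Complex.exp (w.arg * Complex.I) :=
    (Complex.norm_mul_exp_arg_mul_I w).symm
  have hm1 : Complex.exp (Real.pi * Complex.I) = -1 := Complex.exp_pi_mul_I
  have hm2 : Complex.exp (-(Real.pi * Complex.I)) = -1 := by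
    rw [Complex.exp_neg, hm1]; norm_num
  by_contra hcon
  rw [not_le, lt_abs] at hcon
  apply h
  rcases hcon with hcon | hcon
  · refine ⟨‖w‖, norm_pos_iff.2 hw0, w.arg - Real.pi + Ψ, ?_, ?_⟩
    · rw [abs_lt]
      have := Complex.arg_le_pi w
      have := Complex.neg_pi_lt_arg w
      have := Real.pi_pos
      constructor <;> linarith
    · rw [hb1, ← hm2]
      nth_rw 1 [hpol]
      rw [mul_assoc, mul_assoc, ← Complex.exp_add, ← Complex.exp_add]
      push_cast
      ring_nf
  · refine ⟨‖w‖, norm_pos_iff.2 hw0, w.arg + Real.pi + Ψ, ?_, ?_⟩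
    · rw [abs_lt]
      have := Complex.arg_le_pi w
      have := Complex.neg_pi_lt_arg w
      constructor <;> linarith
    · rw [hb1, ← hm1]
      nth_rw 1 [hpol]
      rw [mul_assoc, mul_assoc, ← Complex.exp_add, ← Complex.exp_add]
      push_cast
      ring_nf

lemma eps_le_pi_of_notMem_sector {Ψ ε : ℝ} {b : ℂ} (hb : b ≠ 0) (h : b ∉ sector Ψ ε) :
    ε ≤ Real.pi := by
  have := (abs_nonneg _).trans (abs_arg_le_of_notMem_sector hb h)
  linarith

lemma mem_slitPlane_of_notMem_sector {Ψ ε : ℝ} (hε : 0 < ε) {b : ℂ} (hb : b ≠ 0)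
    (h : b ∉ sector Ψ ε) : -b * Complex.exp (-((Ψ : ℂ) * Complex.I)) ∈ Complex.slitPlane := by
  refine Complex.mem_slitPlane_iff_arg.2 ⟨fun h1 => ?_,
    mul_ne_zero (neg_ne_zero.2 hb) (Complex.exp_ne_zero _)⟩
  have := abs_arg_le_of_notMem_sector hb h
  rw [h1, abs_of_pos Real.pi_pos] at this
  linarith

lemma neg_cos_mul_norm_le_re_of_notMem_sector {Ψ ε : ℝ} (hε : 0 < ε) {b : ℂ} (hb : b ≠ 0)
    (h : b ∉ sector Ψ ε) :
    -Real.cos ε * ‖-b * Complex.exp (-((Ψ : ℂ) * Complex.I))‖ ≤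
      (-b * Complex.exp (-((Ψ : ℂ) * Complex.I))).re := by
  set w := -b * Complex.exp (-((Ψ : ℂ) * Complex.I)) with hw
  have h1 := abs_arg_le_of_notMem_sector hb h
  rw [← hw] at h1
  have h2 : Real.cos (Real.pi - ε) ≤ Real.cos |w.arg| :=
    Real.cos_le_cos_of_nonneg_of_le_pi (abs_nonneg _) (by linarith) h1
  rw [Real.cos_pi_sub, Real.cos_abs] at h2
  calc -Real.cos ε * ‖w‖ ≤ Real.cos w.arg * ‖w‖ :=
        mul_le_mul_of_nonneg_right h2 (norm_nonneg _)
    _ = w.re := by rw [mul_comm, Complex.norm_mul_cos_arg]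

/-- The cone condition `Re w ≥ -cos ε ‖w‖` is the same for all terms, so one constant serves the
whole sequence. -/
lemma exists_mul_add_norm_le_of_notMem_sector {Ψ ε : ℝ} (hε : 0 < ε) {b : ℕ → ℂ}
    (hb : ∀ n, b n ≠ 0) (h : ∀ n, b n ∉ sector Ψ ε) :
    ∃ κ : ℝ, 0 < κ ∧ ∀ n, ∀ r : ℝ, 0 ≤ r →
      κ * (r + ‖-b n * Complex.exp (-((Ψ : ℂ) * Complex.I))‖) ≤
        ‖(r : ℂ) + -b n * Complex.exp (-((Ψ : ℂ) * Complex.I))‖ := by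
  have hεπ : ε ≤ Real.pi := eps_le_pi_of_notMem_sector (hb 0) (h 0)
  have hcos : Real.cos ε < 1 := by
    rw [← Real.cos_zero]
    exact Real.cos_lt_cos_of_nonneg_of_le_pi le_rfl hεπ hε
  have hκ1 : max 0 (Real.cos ε) < 1 := max_lt one_pos hcos
  refine ⟨√((1 - max 0 (Real.cos ε)) / 2), Real.sqrt_pos.2 (by linarith), fun n r hr =>
    mul_add_norm_le_norm_add (le_max_left _ _) hκ1 (le_trans ?_
      (neg_cos_mul_norm_le_re_of_notMem_sector hε (hb n) (h n))) hr⟩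
  exact mul_le_mul_of_nonneg_right (neg_le_neg (le_max_right _ _)) (norm_nonneg _)

/-! ### The logarithm near the vertex and along the ray -/

/-- A logarithm on a sector of a function that is holomorphic and nonzero at the vertex has a limit
there. -/
lemma IsLogOn.exists_tendsto {l G : ℂ → ℂ} {Ψ ε : ℝ} (hε : 0 < ε) (hl : IsLogOn l G (sector Ψ ε))
    (hG : Differentiable ℂ G) (hG0 : G 0 ≠ 0) : ∃ x, Tendsto l (𝓝[sector Ψ ε] 0) (𝓝 x) := by
  obtain ⟨δ, hδ, hball⟩ := Metric.eventually_nhds_iff_ball.1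
    (hG.continuous.continuousAt.eventually_ne hG0)
  obtain ⟨h, -, hh⟩ := exists_log_on_ball hδ hG.differentiableOn hball (Complex.log (G 0))
    (Complex.exp_log hG0)
  -- In the coordinate `ζ = log z` the sector near its vertex becomes a convex half-strip, on which
  -- the difference of the two logarithms is constant.
  set S : Set ℂ := {ζ | ζ.re < Real.log δ} ∩ Complex.im ⁻¹' Metric.ball Ψ ε with hS
  have hSo : IsOpen S := (isOpen_lt Complex.continuous_re continuous_const).inter
    (Metric.isOpen_ball.preimage Complex.continuous_im)
  have hSc : IsPreconnected S := by
    refine Convex.isPreconnected (Convex.inter (convex_halfSpace_re_lt _) ?_)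
    exact (convex_ball Ψ ε).linear_preimage Complex.imLm
  have hmem : ∀ ζ ∈ S, Complex.exp ζ ∈ sector Ψ ε ∧ Complex.exp ζ ∈ Metric.ball (0 : ℂ) δ := by
    rintro ζ ⟨h1, h2⟩
    have h1' : ζ.re < Real.log δ := h1
    refine ⟨⟨Real.exp ζ.re, Real.exp_pos _, ζ.im, ?_, ?_⟩, ?_⟩
    · simpa [Real.dist_eq] using h2
    · rw [Complex.ofReal_exp, ← Complex.exp_add, Complex.re_add_im]
    · rw [mem_ball_zero_iff, Complex.norm_exp, ← Real.lt_log_iff_exp_lt hδ]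
      exact h1'
  set k : ℂ → ℂ := fun ζ => l (Complex.exp ζ) - h (Complex.exp ζ) with hk
  have hkd : DifferentiableOn ℂ k S := by
    refine DifferentiableOn.sub ?_ ?_
    · exact hl.differentiableOn.comp Complex.differentiable_exp.differentiableOn
        fun ζ hζ => (hmem ζ hζ).1
    · exact DifferentiableOn.comp (t := Metric.ball 0 δ)
        (fun z hz => (hh z hz).1.differentiableAt.differentiableWithinAt)
        Complex.differentiable_exp.differentiableOn fun ζ hζ => (hmem ζ hζ).2
  have hexp : ∀ ζ ∈ S, Complex.exp (k ζ) = 1 := by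
    intro ζ hζ
    obtain ⟨h1, h2⟩ := hmem ζ hζ
    rw [hk, Complex.exp_sub, hl.exp_eq _ h1, (hh _ h2).2, div_self (hball _ h2)]
  have hder : S.EqOn (deriv k) 0 := by
    intro ζ hζ
    have h1 := (hkd.differentiableAt (hSo.mem_nhds hζ)).hasDerivAt.cexp
    have h2 : HasDerivAt (fun ζ => Complex.exp (k ζ)) 0 ζ :=
      (hasDerivAt_const ζ (1 : ℂ)).congr_of_eventuallyEq
        (eventually_of_mem (hSo.mem_nhds hζ) hexp)
    have h3 := h1.unique h2
    rw [hexp ζ hζ, one_mul] at h3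
    exact h3
  set ζ₀ : ℂ := ⟨Real.log δ - 1, Ψ⟩ with hζ₀
  have hζS : ζ₀ ∈ S := by
    refine ⟨?_, ?_⟩
    · change ζ₀.re < Real.log δ
      simp [hζ₀]
    · simpa [hζ₀] using hε
  have hconst : ∀ z ∈ sector Ψ ε, z ∈ Metric.ball (0 : ℂ) δ → h z + k ζ₀ = l z := by
    rintro z ⟨r, hr, θ, hθ, hz⟩ hzb
    set ζ : ℂ := ⟨Real.log r, θ⟩ with hζ
    have hzζ : Complex.exp ζ = z := by
      rw [hz, ← Complex.re_add_im ζ, Complex.exp_add, hζ]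
      rw [← Complex.ofReal_exp, Real.exp_log hr]
    have hrδ : r < δ := by
      rw [mem_ball_zero_iff, hz, norm_mul, Complex.norm_exp_ofReal_mul_I, mul_one,
        Complex.norm_real, Real.norm_of_nonneg hr.le] at hzb
      exact hzb
    have hζS' : ζ ∈ S := by
      refine ⟨?_, ?_⟩
      · change ζ.re < Real.log δ
        exact Real.log_lt_log hr hrδ
      · simpa [hζ, Real.dist_eq] using hθ
    have h1 := hSo.is_const_of_deriv_eq_zero hSc hkd hder hζS hζS'
    rw [h1, hk]
    simp only [hzζ]
    ring
  refine ⟨h 0 + k ζ₀, ?_⟩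
  have h1 : Tendsto (fun z => h z + k ζ₀) (𝓝[sector Ψ ε] 0) (𝓝 (h 0 + k ζ₀)) :=
    (((hh 0 (Metric.mem_ball_self hδ)).1.continuousAt.tendsto).mono_left
      nhdsWithin_le_nhds).add_const _
  refine h1.congr' ?_
  filter_upwards [self_mem_nhdsWithin, mem_nhdsWithin_of_mem_nhds (Metric.ball_mem_nhds 0 hδ)]
    with z hz hzb
  exact hconst z hz hzb

lemma ofReal_mul_exp_mem_sector {Ψ ε : ℝ} (hε : 0 < ε) {r : ℝ} (hr : 0 < r) :
    (r : ℂ) * Complex.exp ((Ψ : ℂ) * Complex.I) ∈ sector Ψ ε :=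
  ⟨r, hr, Ψ, by simpa using hε, rfl⟩

lemma IsLogOn.hasDerivAt_ray {l G : ℂ → ℂ} {Ψ ε : ℝ} (hε : 0 < ε)
    (hl : IsLogOn l G (sector Ψ ε)) (hG : Differentiable ℂ G) {r : ℝ} (hr : 0 < r) :
    HasDerivAt (fun t : ℝ => l (t * Complex.exp ((Ψ : ℂ) * Complex.I)))
      (logDeriv (fun u => G (u * Complex.exp ((Ψ : ℂ) * Complex.I))) r) r := by
  set e := Complex.exp ((Ψ : ℂ) * Complex.I) with he
  have hd : DifferentiableOn ℝ (fun t : ℝ => l (t * e)) (Set.Ioi 0) := by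
    refine DifferentiableOn.comp (g := l) (t := sector Ψ ε)
      (hl.differentiableOn.restrictScalars ℝ) ?_ fun t ht => ofReal_mul_exp_mem_sector hε ht
    exact (Complex.ofRealCLM.differentiable.mul_const e).differentiableOn
  have h1 := (hd.differentiableAt (Ioi_mem_nhds hr)).hasDerivAt
  have hH : Differentiable ℂ fun u => G (u * e) := hG.comp (differentiable_id.mul_const e)
  have h2 : HasDerivAt (fun t : ℝ => Complex.exp (l (t * e))) (deriv (fun u => G (u * e)) r) r := by
    refine (hH (r : ℂ)).hasDerivAt.comp_ofReal.congr_of_eventuallyEq ?_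
    filter_upwards [Ioi_mem_nhds hr] with t ht
    exact hl.exp_eq _ (ofReal_mul_exp_mem_sector hε ht)
  have h3 := h1.cexp.unique h2
  have h4 : Complex.exp (l (r * e)) = G (r * e) := hl.exp_eq _ (ofReal_mul_exp_mem_sector hε hr)
  convert! h1 using 1
  rw [logDeriv_apply, ← h3, h4, mul_div_cancel_left₀ _ (by rw [← h4]; exact Complex.exp_ne_zero _)]

/-- For `R ≥ ‖c‖` one has `‖z e - c‖ ≤ 2R`, so rotation and shift only cost the constant `2 ^ ρ` in
the exponent. -/
lemma IsCharacteristic.growth {a : ℕ → ℂ} {α : ℝ} {F : ℂ → ℂ} (hF : IsCharacteristic a α F)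
    (hα : 0 ≤ α) (c : ℂ) {e : ℂ} (he : ‖e‖ = 1) {ρ : ℝ} (hρ : α < ρ) :
    ∃ K : ℝ, ∀ᶠ R : ℝ in atTop, ∀ z, ‖z‖ = R → ‖F (z * e - c)‖ ≤ K * Real.exp (K * R ^ ρ) := by
  have hρ0 : 0 < ρ := hα.trans_lt hρ
  obtain ⟨C, hC⟩ := (hF.order_le ρ hρ).bound
  rw [← comap_norm_atTop, eventually_comap, eventually_atTop] at hC
  obtain ⟨R₀, hR₀⟩ := hC
  refine ⟨max |C| (2 ^ ρ), ?_⟩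
  filter_upwards [eventually_ge_atTop (R₀ + ‖c‖), eventually_ge_atTop ‖c‖] with R h1 h2 z hz
  have hR : 0 ≤ R := (norm_nonneg _).trans h2
  have hze : ‖z * e‖ = R := by rw [norm_mul, he, mul_one, hz]
  have h3 : R - ‖c‖ ≤ ‖z * e - c‖ := by rw [← hze]; exact norm_sub_norm_le _ _
  have h4 : ‖z * e - c‖ ≤ 2 * R := by
    have := norm_sub_le (z * e) c
    rw [hze] at this
    linarith
  have h5 := hR₀ ‖z * e - c‖ (by linarith) _ rfl
  rw [Real.norm_of_nonneg (Real.exp_pos _).le] at h5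
  have h6 : ‖z * e - c‖ ^ ρ ≤ max |C| (2 ^ ρ) * R ^ ρ := by
    calc ‖z * e - c‖ ^ ρ ≤ (2 * R) ^ ρ := Real.rpow_le_rpow (norm_nonneg _) h4 hρ0.le
      _ = 2 ^ ρ * R ^ ρ := Real.mul_rpow (by norm_num) hR
      _ ≤ _ := mul_le_mul_of_nonneg_right (le_max_right _ _) (Real.rpow_nonneg hR _)
  exact h5.trans (mul_le_mul ((le_abs_self C).trans (le_max_left _ _)) (Real.exp_le_exp.2 h6)
    (Real.exp_pos _).le ((abs_nonneg C).trans (le_max_left _ _)))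

/-- Rotating `A b` to centre the branch gives `|A| w` with `w = -b e^{-iΨ}`. The positive factor
splits off the principal logarithm, leaving `log w + ln A + i(Ψ - π)`, whichever value of `ln A` is
chosen. -/
lemma cutPow_mul {Ψ : ℝ} {b logA : ℂ} (hb : b ≠ 0) (s : ℂ) :
    cutPow (Ψ + logA.im) (Complex.exp logA * b) (-s) =
      Complex.exp (-s * (logA + (Ψ - Real.pi) * Complex.I)) *
        (-b * Complex.exp (-((Ψ : ℂ) * Complex.I))) ^ (-s) := by
  set w := -b * Complex.exp (-((Ψ : ℂ) * Complex.I)) with hw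
  have hw0 : w ≠ 0 := mul_ne_zero (neg_ne_zero.2 hb) (Complex.exp_ne_zero _)
  have h1 : Complex.exp logA * b *
      Complex.exp (-(((Ψ + logA.im - Real.pi : ℝ) : ℂ) * Complex.I)) =
        (Real.exp logA.re : ℝ) * w := by
    have h2 : -(((Ψ + logA.im - Real.pi : ℝ) : ℂ) * Complex.I) =
        -((Ψ : ℂ) * Complex.I) + -(logA.im * Complex.I) + Real.pi * Complex.I := by
      push_cast; ring
    have h3 : Complex.exp logA = Complex.exp logA.re * Complex.exp (logA.im * Complex.I) := by
      rw [← Complex.exp_add, Complex.re_add_im]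
    have h4 : Complex.exp (logA.im * Complex.I) * Complex.exp (-(logA.im * Complex.I)) = 1 := by
      rw [← Complex.exp_add, add_neg_cancel, Complex.exp_zero]
    rw [h2, Complex.exp_add, Complex.exp_add, Complex.exp_pi_mul_I, h3, hw, Complex.ofReal_exp]
    linear_combination (-b * Complex.exp logA.re * Complex.exp (-((Ψ : ℂ) * Complex.I))) * h4
  have h5 : logA = logA.re + logA.im * Complex.I := (Complex.re_add_im logA).symm
  rw [cutPow, logBranch, h1, Complex.log_ofReal_mul (Real.exp_pos _) hw0, Real.log_exp,
    Complex.cpow_def_of_ne_zero hw0, ← Complex.exp_add]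
  nth_rw 3 [h5]
  push_cast
  ring_nf

lemma tendsto_ray_sub {Ψ Ψ' ε ε' : ℝ} (hε' : 0 < ε') {c : ℂ}
    (hsub : ∀ᶠ z in sectorAtInfty Ψ' ε', z - c ∈ sector Ψ ε) :
    Tendsto (fun r : ℝ => (r : ℂ) * Complex.exp ((Ψ' : ℂ) * Complex.I)) atTop
        (sectorAtInfty Ψ' ε') ∧
      Tendsto (fun r : ℝ => (r : ℂ) * Complex.exp ((Ψ' : ℂ) * Complex.I) - c) atTop
        (sectorAtInfty Ψ ε) := by
  have hn : ∀ r : ℝ, 0 < r → ‖(r : ℂ) * Complex.exp ((Ψ' : ℂ) * Complex.I)‖ = r := by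
    intro r hr
    rw [norm_mul, Complex.norm_exp_ofReal_mul_I, mul_one, Complex.norm_real,
      Real.norm_of_nonneg hr.le]
  have h1 : Tendsto (fun r : ℝ => ‖(r : ℂ) * Complex.exp ((Ψ' : ℂ) * Complex.I)‖) atTop atTop :=
    tendsto_id.congr' ((eventually_gt_atTop 0).mono fun r hr => (hn r hr).symm)
  have h2 : Tendsto (fun r : ℝ => (r : ℂ) * Complex.exp ((Ψ' : ℂ) * Complex.I)) atTop
      (sectorAtInfty Ψ' ε') :=
    tendsto_inf.2 ⟨tendsto_norm_atTop_iff_cobounded.1 h1, tendsto_principal.2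
      ((eventually_gt_atTop 0).mono fun r hr => ofReal_mul_exp_mem_sector hε' hr)⟩
  refine ⟨h2, tendsto_inf.2 ⟨tendsto_norm_atTop_iff_cobounded.1 ?_,
    tendsto_principal.2 (h2.eventually hsub)⟩⟩
  refine tendsto_atTop_mono (fun r => ?_) (tendsto_atTop_add_const_right _ (-‖c‖) h1)
  have := norm_sub_norm_le ((r : ℂ) * Complex.exp ((Ψ' : ℂ) * Complex.I)) c
  linarith

end ZetaSeq

end

/-! ### The theorem -/

theorem mainTheorem10
    (a : ℕ → ℂ) (α Ψ ε : ℝ) (ha : ZetaSeq.IsAdmissible a α Ψ ε)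
    -- the characteristic function, its logarithm, and the expansion of the latter, with `M = 1`
    (F : ℂ → ℂ) (hF : ZetaSeq.IsCharacteristic a α F)
    (L : ℂ → ℂ) (hL : ZetaSeq.IsLogOn L F (ZetaSeq.sector Ψ ε))
    (m N : ℕ) (δ : ℝ) (d : ℕ → ℕ → ℂ)
    (hexp : ZetaSeq.HasExpansion L α Ψ ε m 1 N δ d)
    -- the linear transformation, and a determination `logA` of `ln A`
    (A B : ℂ) (hA : A ≠ 0) (hne : ∀ n, A * a n + B ≠ 0)
    (logA : ℂ) (hlogA : Complex.exp logA = A)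
    -- a sector free of the shifted sequence `a n + B / A`, which far out lies in the shifted sector
    (Ψ' ε' : ℝ) (hε' : 0 < ε') (hΨ' : |Ψ' - Ψ| < ε)
    (hfree : ∀ n, a n + B / A ∉ ZetaSeq.sector Ψ' ε')
    (hsub : ∀ᶠ z in ZetaSeq.sectorAtInfty Ψ' ε', z - B / A ∈ ZetaSeq.sector Ψ ε)
    -- the branch of `ln F(z - B / A)` in that sector, agreeing with that of `ln F(z)`
    (L' : ℂ → ℂ)
    (hL' : ZetaSeq.IsLogOn L' (fun z => F (z - B / A)) (ZetaSeq.sector Ψ' ε'))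
    (hagree : ∀ᶠ z in ZetaSeq.sectorAtInfty Ψ' ε', L' z = L (z - B / A)) :
    -- `logF` is the value `ln F(-B / A)`
    ∃ logF : ℂ, Tendsto L' (𝓝[ZetaSeq.sector Ψ' ε'] 0) (𝓝 logF) ∧
    ∃ Z : ℂ → ℂ,
      ZetaSeq.IsZetaContinuation (fun n => A * a n + B) α (Ψ' + logA.im) Z ∧
      AnalyticAt ℂ Z 0 ∧
      ((∀ j : ℕ, α - (j : ℝ) / m ≠ 0) → deriv Z 0 = -logF) ∧
      (∀ j : ℕ, α - (j : ℝ) / m = 0 →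
        deriv Z 0 =
          Complex.I * Real.pi * ZetaSeq.Omega (B / A) α m 1 N d j 1
            + ZetaSeq.Omega (B / A) α m 1 N d j 0
            - ZetaSeq.Omega (B / A) α m 1 N d j 1 * logA
            - logF) := by
  open ZetaSeq in
  set c := B / A with hc
  set e := Complex.exp ((Ψ' : ℂ) * Complex.I) with he
  have he0 : e ≠ 0 := Complex.exp_ne_zero _
  have he1 : ‖e‖ = 1 := Complex.norm_exp_ofReal_mul_I _
  have hei : Complex.exp (-((Ψ' : ℂ) * Complex.I)) = e⁻¹ := Complex.exp_neg _
  have hα := ha.exponent_nonneg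
  have hb : ∀ n, a n + c ≠ 0 := by
    intro n h
    apply hne n
    rw [hc] at h
    field_simp at h
    linear_combination h
  set w : ℕ → ℂ := fun n => -(a n + c) * Complex.exp (-((Ψ' : ℂ) * Complex.I)) with hw
  have hwn : ∀ n, ‖w n‖ = ‖a n + c‖ := by
    intro n
    rw [hw]
    simp only
    rw [hei, norm_mul, norm_neg, norm_inv, he1, inv_one, mul_one]
  have hws : ∀ n, w n ∈ Complex.slitPlane := fun n =>
    mem_slitPlane_of_notMem_sector hε' (hb n) (hfree n)
  have hw0 : ∀ n, w n ≠ 0 := fun n => Complex.slitPlane_ne_zero (hws n)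
  obtain ⟨κ, hκ, hcw⟩ := exists_mul_add_norm_le_of_notMem_sector hε' hb hfree
  have hwt : Tendsto (fun n => ‖w n‖) atTop atTop := by
    simp only [hwn]
    exact tendsto_norm_add_const ha.tendsto c
  have hsum : ∀ σ : ℝ, α < σ → Summable fun n => ‖w n‖ ^ (-σ) := by
    intro σ hσ
    simp only [hwn]
    exact summable_rpow_add_const ha.tendsto c (hα.trans hσ.le) (ha.summable_rpow hσ)
  have hG : Differentiable ℂ fun z => F (z - c) := hF.entire.comp (differentiable_id.sub_const c)
  have hH : Differentiable ℂ fun z => F (z * e - c) := hG.comp (differentiable_id.mul_const e)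
  have hzer : ∀ z, analyticOrderAt (fun z => F (z * e - c)) z = Set.encard {n | -w n = z} := by
    intro z
    have hin : HasDerivAt (fun z : ℂ => z * e - c) e z := by
      simpa using ((hasDerivAt_id z).mul_const e).sub_const c
    have h1 : analyticOrderAt (F ∘ fun z : ℂ => z * e - c) z = analyticOrderAt F (z * e - c) :=
      analyticOrderAt_comp_of_deriv_ne_zero (by fun_prop) (by rw [hin.deriv]; exact he0)
    refine h1.trans ?_
    rw [hF.zeros]
    congr 1
    ext n
    simp only [Set.mem_ofPred_eq, hw, hei]
    rw [← div_eq_mul_inv, neg_div, neg_neg, div_eq_iff he0, eq_sub_iff_add_eq]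
  have hG0 : F (0 - c) ≠ 0 := by
    have h1 : analyticOrderAt F (0 - c) = 0 := by
      rw [hF.zeros, Set.encard_eq_zero, Set.eq_empty_iff_forall_notMem]
      intro n hn
      apply hb n
      rw [show a n = 0 - c from hn]
      ring
    exact (hF.entire.analyticAt _).analyticOrderAt_eq_zero.1 h1
  obtain ⟨logF, hlogF⟩ := hL'.exists_tendsto hε' hG hG0
  refine ⟨logF, hlogF, ?_⟩
  have hf0 : Tendsto (fun r : ℝ => L' (r * e)) (𝓝[>] 0) (𝓝 logF) := by
    refine hlogF.comp (tendsto_nhdsWithin_iff.2 ⟨?_, ?_⟩)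
    · have h1 : Continuous fun r : ℝ => (r : ℂ) * e := by fun_prop
      have h2 := h1.tendsto 0
      simp only [Complex.ofReal_zero, zero_mul] at h2
      exact h2.mono_left nhdsWithin_le_nhds
    · filter_upwards [self_mem_nhdsWithin] with r hr
      exact ofReal_mul_exp_mem_sector hε' hr
  have ha0 : a 0 ≠ 0 := norm_pos_iff.1 ha.pos
  -- A sector with `ε > π` would contain every nonzero point, in particular `a 0`; hence `ε ≤ π`.
  have hφ : |Ψ' - Ψ| < Real.pi :=
    hΨ'.trans_le (eps_le_pi_of_notMem_sector ha0 (ha.not_mem 0))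
  obtain ⟨ht', ht⟩ := tendsto_ray_sub hε' hsub
  obtain ⟨κ₀, κ₁, htail, hgen, hres⟩ := hexp.hasTailMod hα hφ ht
  have htail' : HasTailMod α (fun r : ℝ => L' (r * e)) κ₀ κ₁ :=
    htail.congr ((ht'.eventually hagree).mono fun r hr => hr.symm)
  obtain ⟨η, b, hη, hαb, P, hP, hP0, hPs⟩ := exists_hasSum_cpow_neg hws hκ hcw hwt hα hsum hH hzer
    (fun ρ hρ => hF.growth hα c he1 hρ) (fun r hr => hL'.hasDerivAt_ray hε' hG hr) hf0 htail'
  obtain ⟨Z, hZ, hZm, hZ0, hZd⟩ := exists_continuation hw0 hα hsum hη hαb hP hP0 hPs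
    (logA + (Ψ' - Real.pi) * Complex.I)
  refine ⟨Z, ⟨fun s hs => ?_, hZm⟩, hZ0, fun h => ?_, fun j hj => ?_⟩
  · convert! hZ s hs using 2 with n
    rw [← cutPow_mul (hb n), hlogA]
    congr 1
    rw [hc]
    field_simp
  · obtain ⟨rfl, rfl⟩ := hgen h
    rw [hZd]
    ring
  -- The term `iΨ' Ω_{j,1}` of `κ₀` cancels that of `τ κ₁`, and `-(-iπ)` leaves `+iπ Ω_{j,1}`.
  · obtain ⟨h1, h0⟩ := hres j hj
    rw [hZd, h0, h1]
    ring
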